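/- Let $n\ge 1$. For a compact set $K\subset\mathbb{R}^n$ and real $p\neq 0$, the Riesz $p$-energy is \[ V_p(K)=\begin{cases}\displaystyle\min_\mu \int_K\!\int_K |x-y|^{-p}\,d\mu(x)\,d\mu(y), & p>0,\\[2mm] \displaystyle\max_\mu \int_K\!\int_K |x-y|^{-p}\,d\mu(x)\,d\mu(y), & p<0,\end{cases} \] and the logarithmic energy is $V_{\log}(K)=\min_\mu\int_K\!\int_K \log\frac{1}{|x-y|}\,d\mu(x)\,d\mu(y)$, where $\mu$ ranges over the Borel probability measures on $K$. For the empty set, $V_p(\emptyset)=+\infty$ if $p>0$, $V_p(\emptyset)=0$ if $p<0$, and $V_{\log}(\emptyset)=+\infty$. The Riesz $p$-capacity of $K$ is $\operatorname{cap}_p(K)=V_p(K)^{-1/p}$ for $p\neq 0$, and $\operatorname{cap}_0(K)=\exp(-V_{\log}(K))$. Let $p,q$ be real numbers with $p<0$ and $q<n$. (i) The ratio $\operatorname{cap}_q(K)/\operatorname{cap}_p(K)$ has a maximizer, with finite maximal value, among the compact sets $K\subset\mathbb{R}^n$ with $\operatorname{cap}_p(K)>0$. (ii) If in addition $q<-2$,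 then the maximizer can be taken to be a finite set consisting of between $2$ and $n+1$ points, each of which is an extreme point of the convex hull of the set. (iii) If in addition $p<-1$, then the maximizer can be taken to be convex. -/

import Mathlib

open MeasureTheory
open scoped ENNReal

noncomputable section

/-- The Borel probability measures on `ℝⁿ` that are carried by the set `K`. -/
def probOn {n : ℕ} (K : Set (EuclideanSpace ℝ (Fin n))) :
    Set (Measure (EuclideanSpace ℝ (Fin n))) :=
  {μ | IsProbabilityMeasure μ ∧ μ Kᶜ = 0}

/-- The mutual energy `∬ |x - y|^(-p) dμ(x) dμ(y)`, with values in `[0, ∞]`. For `p > 0` the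
kernel equals `∞` on the diagonal, for `p < 0` it vanishes there. -/
def rieszEnergyOf {n : ℕ} (p : ℝ) (μ : Measure (EuclideanSpace ℝ (Fin n))) : ℝ≥0∞ :=
  ∫⁻ x, ∫⁻ y, edist x y ^ (-p) ∂μ ∂μ

/-- The Riesz `p`-energy `V_p(K)`: for `p > 0` the minimum, and for `p < 0` the maximum, of
`∬ |x - y|^(-p) dμ dμ` over the probability measures on `K`. It is used only for `p ≠ 0`. For empty
`K` it equals `∞` if `p > 0` and `0` if `p < 0`. -/
def rieszEnergy {n : ℕ} (p : ℝ) (K : Set (EuclideanSpace ℝ (Fin n))) : ℝ≥0∞ :=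
  if 0 < p then ⨅ μ ∈ probOn K, rieszEnergyOf p μ
  else ⨆ μ ∈ probOn K, rieszEnergyOf p μ

/-- The logarithmic kernel `log (1 / |x - y|)`, with the value `+∞` on the diagonal. -/
def logKernel {n : ℕ} (x y : EuclideanSpace ℝ (Fin n)) : EReal :=
  ENNReal.log (edist x y)⁻¹

/-- `∬ log (1 / |x - y|) dμ(x) dμ(y)`, as the integral of the positive part minus the integral of
the negative part. For a finite measure on a bounded set the second integral is finite. -/
def logEnergyOf {n : ℕ} (μ : Measure (EuclideanSpace ℝ (Fin n))) : EReal :=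
  ((∫⁻ x, ∫⁻ y, (logKernel x y).toENNReal ∂μ ∂μ : ℝ≥0∞) : EReal) -
    ((∫⁻ x, ∫⁻ y, (-logKernel x y).toENNReal ∂μ ∂μ : ℝ≥0∞) : EReal)

/-- The logarithmic energy `V_log(K)`; it equals `+∞` for empty `K`. -/
def logEnergy {n : ℕ} (K : Set (EuclideanSpace ℝ (Fin n))) : EReal :=
  ⨅ μ ∈ probOn K, logEnergyOf μ

/-- The Riesz `p`-capacity: `V_p(K)^(-1/p)` for `p ≠ 0`, and `exp (-V_log(K))` for `p = 0`. -/
def rieszCap {n : ℕ} (p : ℝ) (K : Set (EuclideanSpace ℝ (Fin n))) : ℝ≥0∞ :=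
  if p = 0 then EReal.exp (-logEnergy K) else rieszEnergy p K ^ (-1 / p)

/-- The compact subsets of `ℝⁿ` with positive `p`-capacity. -/
def posCapCompacts (n : ℕ) (p : ℝ) : Set (Set (EuclideanSpace ℝ (Fin n))) :=
  {K | IsCompact K ∧ 0 < rieszCap p K}

/-- `K` maximizes `cap_q / cap_p` among the compact subsets of `ℝⁿ` with positive `p`-capacity. -/
def IsCapRatioMaximizer {n : ℕ} (p q : ℝ) (K : Set (EuclideanSpace ℝ (Fin n))) : Prop :=
  K ∈ posCapCompacts n p ∧
    IsMaxOn (fun L => rieszCap q L / rieszCap p L) (posCapCompacts n p) K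

end

open Filter Topology

/-! In every order the capacity is the supremum of `capOf q μ` over the probability measures on the
set, and capacities of all orders scale by the same factor under dilations. The ratio can therefore
be studied on compact sets of diameter one in the unit ball. Along an ultrafilter, a maximizing
sequence of sets and measures has a weak limit measure and a limit set that carries it. By
`le_capOf_of_tendsto` the numerator can only jump up in the limit, and by `rieszCap_limPoints_le`
the denominator can only drop: for `p < 0` energies are suprema over finite configurations, and
every configuration in the limit set is approximated within the sets of the sequence. So the limit
set is a maximizer.

For orders at most `-1` the kernel is convex in each variable, and by Jensen's inequality a set and
its convex hull have equal capacity (`rieszCap_convexHull_le`). If `p` is such an order, the closed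
hull of a maximizer is a maximizer; if `q` is, nonextreme points of a finite maximizer can be
deleted.

For `q < -2`, optimal weights on a finite set satisfy a second-order condition: `|x - y|^(-q)` is
conditionally negative semidefinite on their support. By Schoenberg's theorem (`sum_rpow_neg`) its
power `|x - y|^2` is then strictly so, which excludes affine dependences and leaves at most `n + 1`
points. Compactness of such configurations yields a finite subset with the full `q`-capacity; its
`p`-capacity is no larger. -/

/-- The capacity of a single measure. -/
noncomputable def capOf {n : ℕ} (q : ℝ) (μ : Measure (EuclideanSpace ℝ (Fin n))) : ℝ≥0∞ :=
  if q = 0 then EReal.exp (-logEnergyOf μ) else rieszEnergyOf q μ ^ (-1 / q)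

/-! ### Capacity as a supremum over measures -/

section

variable {n : ℕ}

local notation "E" => EuclideanSpace ℝ (Fin n)

/-- The map from energy to capacity is increasing for `q < 0` and decreasing for `q ≥ 0`, exactly
where the energy is a supremum, respectively an infimum. This unifies the three cases. -/
lemma rieszCap_eq_iSup (q : ℝ) (K : Set E) : rieszCap q K = ⨆ μ ∈ probOn K, capOf q μ := by
  unfold rieszCap capOf
  rcases lt_trichotomy q 0 with hq | rfl | hq
  · simp only [hq.ne, if_false, rieszEnergy, not_lt.2 hq.le]
    have h : 0 < -1 / q := div_pos_of_neg_of_neg (by norm_num) hq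
    have := fun x => (ENNReal.orderIsoRpow (-1 / q) h).map_iSup x (ι := Measure E)
    simp only [ENNReal.orderIsoRpow_apply] at this
    rw [this]
    refine iSup_congr fun μ => ?_
    exact (ENNReal.orderIsoRpow (-1 / q) h).map_iSup _
  · simp only [if_true, logEnergy]
    apply le_antisymm
    · have key : -(⨆ μ ∈ probOn K, -logEnergyOf μ) ≤ ⨅ μ ∈ probOn K, logEnergyOf μ :=
        le_iInf₂ fun μ hμ => EReal.neg_le_of_neg_le (le_iSup₂_of_le μ hμ le_rfl)
      have := EReal.expOrderIso.monotone (EReal.neg_le_of_neg_le key)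
      refine this.trans ?_
      rw [EReal.expOrderIso.map_iSup]
      refine iSup_mono fun μ => ?_
      rw [EReal.expOrderIso.map_iSup]
      rfl
    · refine iSup₂_le fun μ hμ => EReal.exp_monotone ?_
      exact EReal.neg_le_neg_iff.2 (iInf₂_le μ hμ)
  · simp only [hq.ne', if_false, rieszEnergy, hq, if_true]
    have h : 0 < 1 / q := by positivity
    have e : ∀ x : ℝ≥0∞, x ^ (-1 / q) = (x⁻¹) ^ (1 / q) := fun x => by
      rw [neg_div, ENNReal.rpow_neg, ENNReal.inv_rpow]
    have := fun x => (ENNReal.orderIsoRpow (1 / q) h).map_iSup x (ι := Measure E)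
    simp only [ENNReal.orderIsoRpow_apply] at this
    simp only [e, ENNReal.inv_iInf]
    rw [this]
    refine iSup_congr fun μ => ?_
    exact (ENNReal.orderIsoRpow (1 / q) h).map_iSup _

lemma capOf_le_rieszCap (q : ℝ) {K : Set E} {μ : Measure E} (hμ : μ ∈ probOn K) :
    capOf q μ ≤ rieszCap q K := by
  rw [rieszCap_eq_iSup]
  exact le_iSup₂_of_le μ hμ le_rfl

lemma probOn_mono {K L : Set E} (h : K ⊆ L) : probOn K ⊆ probOn L := fun _ hμ =>
  ⟨hμ.1, measure_mono_null (Set.compl_subset_compl.2 h) hμ.2⟩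

lemma rieszCap_mono (q : ℝ) {K L : Set E} (h : K ⊆ L) : rieszCap q K ≤ rieszCap q L := by
  rw [rieszCap_eq_iSup]
  exact iSup₂_le fun μ hμ => capOf_le_rieszCap q (probOn_mono h hμ)

lemma ae_mem_of_mem_probOn {K : Set E} {μ : Measure E} (hμ : μ ∈ probOn K) : ∀ᵐ x ∂μ, x ∈ K :=
  hμ.2

lemma ae_ae_mem_of_mem_probOn {K : Set E} {μ : Measure E} (hμ : μ ∈ probOn K) :
    ∀ᵐ x ∂μ, ∀ᵐ y ∂μ, x ∈ K ∧ y ∈ K := by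
  filter_upwards [ae_mem_of_mem_probOn hμ] with x hx
  filter_upwards [ae_mem_of_mem_probOn hμ] with y hy using ⟨hx, hy⟩

lemma continuous_logKernel : Continuous fun z : E × E => logKernel z.1 z.2 := by
  unfold logKernel
  exact ENNReal.continuous_log.comp (continuous_inv.comp (by fun_prop))

lemma continuous_edist_rpow (p : ℝ) : Continuous fun z : E × E => edist z.1 z.2 ^ p :=
  ENNReal.continuous_rpow_const.comp (by fun_prop)

lemma lintegral_lintegral_eq_prod {f : E → E → ℝ≥0∞} (μ : Measure E) [IsProbabilityMeasure μ]
    (hf : Measurable fun z : E × E => f z.1 z.2) :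
    ∫⁻ x, ∫⁻ y, f x y ∂μ ∂μ = ∫⁻ z, f z.1 z.2 ∂(μ.prod μ) :=
  (lintegral_prod _ hf.aemeasurable).symm

lemma lintegral_lintegral_mono_of_mem_probOn {f g : E → E → ℝ≥0∞} {K : Set E} {μ : Measure E}
    (hμ : μ ∈ probOn K) (h : ∀ x ∈ K, ∀ y ∈ K, f x y ≤ g x y) :
    ∫⁻ x, ∫⁻ y, f x y ∂μ ∂μ ≤ ∫⁻ x, ∫⁻ y, g x y ∂μ ∂μ := by
  refine lintegral_mono_ae ?_
  filter_upwards [ae_ae_mem_of_mem_probOn hμ] with x hx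
  refine lintegral_mono_ae ?_
  filter_upwards [hx] with y hy using h x hy.1 y hy.2

lemma logEnergyOf_of_edist_le_one {K : Set E} (hK : ∀ x ∈ K, ∀ y ∈ K, edist x y ≤ 1)
    {μ : Measure E} (hμ : μ ∈ probOn K) :
    logEnergyOf μ = ((∫⁻ x, ∫⁻ y, (logKernel x y).toENNReal ∂μ ∂μ : ℝ≥0∞) : EReal) := by
  have : ∫⁻ x, ∫⁻ y, (-logKernel x y).toENNReal ∂μ ∂μ = 0 := by
    refine le_antisymm ?_ bot_le
    refine (lintegral_lintegral_mono_of_mem_probOn (g := fun _ _ => 0) hμ ?_).trans (by simp)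
    intro x hx y hy
    rw [EReal.toENNReal_of_nonpos]
    rw [logKernel, ENNReal.log_inv, neg_neg]
    exact ENNReal.log_le_zero_iff.2 (hK x hx y hy)
  rw [logEnergyOf, this]
  simp

lemma capOf_le_one (q : ℝ) {K : Set E} (hK : ∀ x ∈ K, ∀ y ∈ K, edist x y ≤ 1)
    {μ : Measure E} (hμ : μ ∈ probOn K) : capOf q μ ≤ 1 := by
  have := hμ.1
  unfold capOf
  rcases lt_trichotomy q 0 with hq | rfl | hq
  · rw [if_neg hq.ne]
    refine ENNReal.rpow_le_one ?_ (div_pos_of_neg_of_neg (by norm_num) hq).le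
    refine (lintegral_lintegral_mono_of_mem_probOn (g := fun _ _ => 1) hμ ?_).trans (by simp)
    exact fun x hx y hy => ENNReal.rpow_le_one (hK x hx y hy) (by linarith)
  · rw [if_pos rfl, logEnergyOf_of_edist_le_one hK hμ]
    rw [← EReal.exp_zero]
    apply EReal.exp_monotone
    rw [EReal.neg_le_zero]
    exact EReal.coe_ennreal_nonneg _
  · rw [if_neg hq.ne', neg_div]
    refine ENNReal.rpow_le_one_of_one_le_of_neg ?_ (by simpa using hq)
    refine le_trans (by simp) (lintegral_lintegral_mono_of_mem_probOn (f := fun _ _ => 1) hμ ?_)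
    intro x hx y hy
    rw [ENNReal.rpow_neg, ENNReal.one_le_inv]
    exact ENNReal.rpow_le_one (hK x hx y hy) hq.le

lemma rieszCap_le_one (q : ℝ) {K : Set E} (hK : ∀ x ∈ K, ∀ y ∈ K, edist x y ≤ 1) :
    rieszCap q K ≤ 1 := by
  rw [rieszCap_eq_iSup]
  exact iSup₂_le fun μ hμ => capOf_le_one q hK hμ

/-! ### Scaling under dilations -/

/-- The decomposition into positive and negative parts, rearranged without subtraction so that it
can be integrated in `[0, ∞]`. -/
lemma ereal_toENNReal_add_coe (l : EReal) (hl : l ≠ ⊥) (r : ℝ) :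
    (l + r).toENNReal + (-l).toENNReal + ENNReal.ofReal (-r) =
      (-(l + r)).toENNReal + l.toENNReal + ENNReal.ofReal r := by
  induction l with
  | bot => simp at hl
  | top => simp
  | coe l =>
    rw [← EReal.coe_add, ← EReal.coe_neg, ← EReal.coe_neg]
    simp only [EReal.toENNReal_of_ne_top (EReal.coe_ne_top _), EReal.toReal_coe]
    rw [← ENNReal.toReal_eq_toReal_iff' (by finiteness) (by finiteness)]
    rw [ENNReal.toReal_add (by finiteness) (by finiteness),
      ENNReal.toReal_add (by finiteness) (by finiteness),
      ENNReal.toReal_add (by finiteness) (by finiteness),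
      ENNReal.toReal_add (by finiteness) (by finiteness)]
    simp only [ENNReal.toReal_ofReal']
    have h : ∀ t : ℝ, max t 0 - max (-t) 0 = t := fun t => max_zero_sub_eq_self t
    linarith [h l, h r, h (l + r)]

lemma measurable_logKernel_toENNReal :
    Measurable fun z : E × E => (logKernel z.1 z.2).toENNReal :=
  EReal.continuous_toENNReal.measurable.comp continuous_logKernel.measurable

lemma measurable_neg_logKernel_toENNReal :
    Measurable fun z : E × E => (-logKernel z.1 z.2).toENNReal :=
  EReal.continuous_toENNReal.measurable.comp
    (continuous_neg.measurable.comp continuous_logKernel.measurable)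

lemma logKernel_ne_bot (x y : E) : logKernel x y ≠ ⊥ := by
  simp [logKernel, ENNReal.log_inv, edist_ne_top]

/-- Boundedness of `K` makes both negative parts integrable, so the difference defining the
logarithmic energy is never `∞ - ∞`. -/
lemma logEnergyOf_map {K : Set E} (hK : Bornology.IsBounded K) {μ : Measure E}
    (hμ : μ ∈ probOn K) {f : E → E} (hf : Measurable f) {c : ℝ} (hc : 0 < c)
    (h : ∀ x y, edist (f x) (f y) = ENNReal.ofReal c * edist x y) :
    logEnergyOf (μ.map f) = logEnergyOf μ + (-Real.log c : ℝ) := by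
  have := hμ.1
  have := Measure.isProbabilityMeasure_map (μ := μ) hf.aemeasurable
  have hker : ∀ x y, logKernel (f x) (f y) = logKernel x y + (-Real.log c : ℝ) := by
    intro x y
    rw [logKernel, logKernel, h, ENNReal.log_inv, ENNReal.log_mul_add,
      ENNReal.log_ofReal_of_pos hc, ENNReal.log_inv, EReal.neg_add (by simp) (by simp), add_comm,
      EReal.coe_neg]
    rfl
  have hp := measurable_logKernel_toENNReal (n := n)
  have hm := measurable_neg_logKernel_toENNReal (n := n)
  have hff : Measurable fun z : E × E => (f z.1, f z.2) := by fun_prop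
  have tr : ∀ g : E × E → ℝ≥0∞, Measurable g →
      ∫⁻ x, ∫⁻ y, g (x, y) ∂(μ.map f) ∂(μ.map f) = ∫⁻ z, g (f z.1, f z.2) ∂(μ.prod μ) := by
    intro g hg
    rw [lintegral_lintegral_eq_prod _ (f := fun x y => g (x, y)) hg,
      Measure.map_prod_map _ _ hf hf, lintegral_map hg (hf.prodMap hf)]
    rfl
  set r : ℝ := -Real.log c
  have e1 := tr _ hp
  have e2 := tr _ hm
  simp only [hker] at e1 e2
  rw [logEnergyOf, logEnergyOf, e1, e2, lintegral_lintegral_eq_prod _ hp,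
    lintegral_lintegral_eq_prod _ hm]
  have hp' : Measurable fun z : E × E => (logKernel z.1 z.2 + (r : EReal)).toENNReal := by
    have := hp.comp hff
    simpa only [Function.comp_def, hker] using this
  have hm' : Measurable fun z : E × E => (-(logKernel z.1 z.2 + (r : EReal))).toENNReal := by
    have := hm.comp hff
    simpa only [Function.comp_def, hker] using this
  have id := lintegral_congr (μ := μ.prod μ) fun z : E × E =>
    ereal_toENNReal_add_coe (logKernel z.1 z.2) (logKernel_ne_bot _ _) r
  rw [lintegral_add_right _ measurable_const, lintegral_add_right _ measurable_const,
    lintegral_add_right _ hm, lintegral_add_right _ hp] at id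
  simp only [lintegral_const, measure_univ, mul_one] at id
  obtain ⟨D, hD⟩ : ∃ D : ℝ, ∀ x ∈ K, ∀ y ∈ K, dist x y ≤ D := by
    obtain ⟨D, hD⟩ := Metric.isBounded_iff.1 hK
    exact ⟨D, fun x hx y hy => hD hx hy⟩
  have key : ∀ x ∈ K, ∀ y ∈ K, (-logKernel x y).toENNReal ≤ ENNReal.ofReal (Real.log (max D 1)) := by
    intro x hx y hy
    rw [logKernel, ENNReal.log_inv, neg_neg]
    have : edist x y ≤ ENNReal.ofReal (max D 1) := by
      rw [edist_dist]
      exact ENNReal.ofReal_le_ofReal ((hD x hx y hy).trans (le_max_left _ _))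
    have h2 := EReal.toENNReal_le_toENNReal (ENNReal.log_monotone this)
    rw [ENNReal.log_ofReal_of_pos (by positivity)] at h2
    simpa only [EReal.toENNReal_of_ne_top (EReal.coe_ne_top _), EReal.toReal_coe] using h2
  have fin1 : ∫⁻ z, (-logKernel z.1 z.2).toENNReal ∂(μ.prod μ) ≠ ⊤ := by
    rw [← lintegral_lintegral_eq_prod (f := fun x y => (-logKernel x y).toENNReal) _ hm]
    refine ne_top_of_le_ne_top ?_ (lintegral_lintegral_mono_of_mem_probOn hμ key)
    simp
  have fin2 : ∫⁻ z, (-(logKernel z.1 z.2 + (r : EReal))).toENNReal ∂(μ.prod μ) ≠ ⊤ := by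
    have hle : ∀ z : E × E, (-(logKernel z.1 z.2 + (r : EReal))).toENNReal ≤
        (-logKernel z.1 z.2).toENNReal + ENNReal.ofReal (-r) := by
      intro z
      rw [EReal.neg_add (by simp) (by simp), sub_eq_add_neg]
      refine EReal.toENNReal_add_le.trans ?_
      rw [← EReal.coe_neg, EReal.toENNReal_of_ne_top (EReal.coe_ne_top _), EReal.toReal_coe]
    refine ne_top_of_le_ne_top ?_ (lintegral_mono hle)
    rw [lintegral_add_right _ measurable_const]
    simp [fin1]
  generalize ∫⁻ z, (-logKernel z.1 z.2).toENNReal ∂(μ.prod μ) = B at *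
  generalize ∫⁻ z, (logKernel z.1 z.2).toENNReal ∂(μ.prod μ) = A at *
  generalize ∫⁻ z, (-(logKernel z.1 z.2 + (r : EReal))).toENNReal ∂(μ.prod μ) = B' at *
  generalize ∫⁻ z, (logKernel z.1 z.2 + (r : EReal)).toENNReal ∂(μ.prod μ) = A' at *
  lift B to NNReal using fin1
  lift B' to NNReal using fin2
  by_cases hA : A = ⊤
  · subst hA
    have hA' : A' = ⊤ := by
      by_contra hne
      have : A' + B + ENNReal.ofReal (-r) ≠ ⊤ := by finiteness
      rw [id] at this
      simp at this
    subst hA'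
    simp
  · have hA' : A' ≠ ⊤ := by
      rintro rfl
      have : (B' : ℝ≥0∞) + A + ENNReal.ofReal r ≠ ⊤ := by finiteness
      rw [← id] at this
      simp at this
    lift A to NNReal using hA
    lift A' to NNReal using hA'
    have := congrArg ENNReal.toReal id
    rw [ENNReal.toReal_add (by finiteness) (by finiteness),
      ENNReal.toReal_add (by finiteness) (by finiteness),
      ENNReal.toReal_add (by finiteness) (by finiteness),
      ENNReal.toReal_add (by finiteness) (by finiteness)] at this
    simp only [ENNReal.toReal_ofReal', ENNReal.coe_toReal] at this
    have h3 : max r 0 - max (-r) 0 = r := max_zero_sub_eq_self r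
    have h4 : (A' : ℝ) - B' = A - B + r := by linarith
    have h5 := congrArg (fun t : ℝ => (t : EReal)) h4
    simpa only [EReal.coe_sub, EReal.coe_add, EReal.coe_nnreal_eq_coe_real] using h5

lemma rieszEnergyOf_map {q : ℝ} {μ : Measure E} [IsProbabilityMeasure μ] {f : E → E}
    (hf : Measurable f) {c : ℝ}
    (h : ∀ x y, edist (f x) (f y) = ENNReal.ofReal c * edist x y) :
    rieszEnergyOf q (μ.map f) = ENNReal.ofReal c ^ (-q) * rieszEnergyOf q μ := by
  have := Measure.isProbabilityMeasure_map (μ := μ) hf.aemeasurable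
  have hm := (continuous_edist_rpow (n := n) (-q)).measurable
  rw [rieszEnergyOf, rieszEnergyOf, lintegral_lintegral_eq_prod _ hm,
    lintegral_lintegral_eq_prod _ hm, Measure.map_prod_map _ _ hf hf,
    lintegral_map hm (hf.prodMap hf), ← lintegral_const_mul _ hm]
  refine lintegral_congr fun z => ?_
  rw [Prod.map_fst, Prod.map_snd, h, ENNReal.mul_rpow_of_ne_top (by simp) (edist_ne_top _ _)]

lemma capOf_map (q : ℝ) {K : Set E} (hK : Bornology.IsBounded K) {μ : Measure E}
    (hμ : μ ∈ probOn K) {f : E → E} (hf : Measurable f) {c : ℝ} (hc : 0 < c)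
    (h : ∀ x y, edist (f x) (f y) = ENNReal.ofReal c * edist x y) :
    capOf q (μ.map f) = ENNReal.ofReal c * capOf q μ := by
  have := hμ.1
  have hc0 : ENNReal.ofReal c ≠ 0 := by simpa using hc
  unfold capOf
  split_ifs with hq
  · rw [logEnergyOf_map hK hμ hf hc h, EReal.neg_add (by simp) (by simp), sub_eq_add_neg,
      ← EReal.coe_neg, neg_neg, EReal.exp_add, EReal.exp_coe, Real.exp_log hc, mul_comm]
  · have h0 : ENNReal.ofReal c ^ (-q) ≠ 0 :=
      (ENNReal.rpow_pos hc0.bot_lt ENNReal.ofReal_ne_top).ne'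
    have ht : ENNReal.ofReal c ^ (-q) ≠ ⊤ := ENNReal.rpow_ne_top_of_ne_zero hc0 ENNReal.ofReal_ne_top
    rw [rieszEnergyOf_map hf h, ENNReal.mul_rpow_eq_ite, if_neg (by simp [h0, ht]),
      ← ENNReal.rpow_mul, show -q * (-1 / q) = 1 by field_simp, ENNReal.rpow_one]

lemma map_mem_probOn_image {K : Set E} (hK : IsCompact K) {μ : Measure E}
    (hμ : μ ∈ probOn K) {f : E → E} (hf : Continuous f) : μ.map f ∈ probOn (f '' K) := by
  have := hμ.1
  refine ⟨Measure.isProbabilityMeasure_map hf.measurable.aemeasurable, ?_⟩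
  rw [Measure.map_apply hf.measurable (hK.image hf).measurableSet.compl]
  refine measure_mono_null ?_ hμ.2
  exact fun x hx hxK => hx ⟨x, hxK, rfl⟩

lemma mul_rieszCap_le_image (q : ℝ) {K : Set E} (hK : IsCompact K) {f : E → E}
    (hf : Continuous f) {c : ℝ} (hc : 0 < c)
    (h : ∀ x y, edist (f x) (f y) = ENNReal.ofReal c * edist x y) :
    ENNReal.ofReal c * rieszCap q K ≤ rieszCap q (f '' K) := by
  rw [rieszCap_eq_iSup q K]
  simp only [ENNReal.mul_iSup]
  refine iSup₂_le fun μ hμ => ?_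
  rw [← capOf_map q hK.isBounded hμ hf.measurable hc h]
  exact capOf_le_rieszCap q (map_mem_probOn_image hK hμ hf)

/-- Capacities scale linearly under dilations. -/
lemma rieszCap_image_smul_sub (q : ℝ) {K : Set E} (hK : IsCompact K) (x₀ : E) {c : ℝ}
    (hc : 0 < c) : rieszCap q ((fun x => c • (x - x₀)) '' K) = ENNReal.ofReal c * rieszCap q K := by
  have hf : Continuous fun x : E => c • (x - x₀) := by fun_prop
  have hg : Continuous fun x : E => c⁻¹ • x + x₀ := by fun_prop
  have hc' : 0 < c⁻¹ := inv_pos.2 hc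
  have key : ∀ a > 0, ∀ x y z w : E, z - w = a • (x - y) →
      edist z w = ENNReal.ofReal a * edist x y := by
    intro a ha x y z w h
    rw [edist_dist, edist_dist, ← ENNReal.ofReal_mul ha.le, dist_eq_norm, dist_eq_norm, h,
      norm_smul, Real.norm_of_nonneg ha.le]
  refine le_antisymm ?_ (mul_rieszCap_le_image q hK hf hc fun x y => key c hc _ _ _ _ ?_)
  -- The reverse inequality is the same estimate for the inverse dilation.
  · have := mul_rieszCap_le_image q (hK.image hf) hg hc' fun x y => key _ hc' _ _ _ _ (by
      rw [smul_sub]; abel)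
    rw [← Set.image_comp] at this
    have hid : (fun x : E => c⁻¹ • x + x₀) ∘ (fun x => c • (x - x₀)) = id := by
      funext x
      simp [smul_smul, inv_mul_cancel₀ hc.ne']
    rw [hid, Set.image_id] at this
    set C := rieszCap q ((fun x => c • (x - x₀)) '' K)
    calc C = ENNReal.ofReal c * (ENNReal.ofReal c⁻¹ * C) := by
          rw [← mul_assoc, ← ENNReal.ofReal_mul hc.le, mul_inv_cancel₀ hc.ne', ENNReal.ofReal_one,
            one_mul]
      _ ≤ _ := by gcongr
  · rw [← smul_sub]
    congr 1
    abel

/-! ### Finite configurations and energies of negative order -/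

/-- The test measure is a sum of weighted point masses. The points `x i` may coincide, which is
needed for limits of configurations and for convex combinations. -/
lemma ofReal_energy_le_rieszEnergy {p : ℝ} (hp : p < 0) {K : Set E} {ι : Type*} [Fintype ι]
    {x : ι → E} (hx : ∀ i, x i ∈ K) {w : ι → ℝ} (hw : w ∈ stdSimplex ℝ ι) :
    ENNReal.ofReal (∑ i, ∑ j, w i * w j * dist (x i) (x j) ^ (-p)) ≤ rieszEnergy p K := by
  set μ : Measure E := ∑ i, ENNReal.ofReal (w i) • Measure.dirac (x i) with hμ
  have hint : ∀ f : E → ℝ≥0∞, ∫⁻ y, f y ∂μ = ∑ i, ENNReal.ofReal (w i) * f (x i) := by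
    intro f
    rw [hμ, lintegral_finsetSum_measure]
    simp [lintegral_smul_measure]
  have hmem : μ ∈ probOn K := by
    constructor
    · constructor
      rw [hμ]
      simp only [Measure.coe_finsetSum, Finset.sum_apply, Measure.smul_apply, measure_univ,
        smul_eq_mul, mul_one]
      rw [← ENNReal.ofReal_sum_of_nonneg fun i _ => hw.1 i, hw.2, ENNReal.ofReal_one]
    · rw [hμ]
      simp only [Measure.coe_finsetSum, Finset.sum_apply, Measure.smul_apply, smul_eq_mul]
      refine Finset.sum_eq_zero fun i _ => ?_
      have : Measure.dirac (x i) Kᶜ = 0 := by simp [Measure.dirac_apply, hx i]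
      rw [this, mul_zero]
  have hE : rieszEnergyOf p μ =
      ENNReal.ofReal (∑ i, ∑ j, w i * w j * dist (x i) (x j) ^ (-p)) := by
    rw [rieszEnergyOf, hint, ENNReal.ofReal_sum_of_nonneg]
    · refine Finset.sum_congr rfl fun i _ => ?_
      rw [hint, ENNReal.ofReal_sum_of_nonneg, Finset.mul_sum]
      · refine Finset.sum_congr rfl fun j _ => ?_
        rw [edist_dist, ENNReal.ofReal_rpow_of_nonneg dist_nonneg (by linarith), ← mul_assoc,
          ← ENNReal.ofReal_mul (hw.1 i),
          ← ENNReal.ofReal_mul (mul_nonneg (hw.1 i) (hw.1 j))]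
      · intro j _
        have := hw.1 i; have := hw.1 j
        positivity
    · intro i _
      refine Finset.sum_nonneg fun j _ => ?_
      have := hw.1 i; have := hw.1 j
      positivity
  rw [← hE, rieszEnergy, if_neg hp.le.not_gt]
  exact le_iSup₂_of_le μ hmem le_rfl

lemma lintegral_simpleFunc_energy {p : ℝ} (hp : p < 0) (μ : Measure E) [IsProbabilityMeasure μ]
    (f : SimpleFunc E E) : ∃ w : E → ℝ, (∀ x, 0 ≤ w x) ∧ ∑ x ∈ f.range, w x = 1 ∧
      ∫⁻ x, ∫⁻ y, edist (f x) (f y) ^ (-p) ∂μ ∂μ =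
      ENNReal.ofReal (∑ x ∈ f.range, ∑ y ∈ f.range, w x * w y * dist x y ^ (-p)) := by
  have hint : ∀ g : E → ℝ≥0∞, ∫⁻ y, g (f y) ∂μ = ∑ b ∈ f.range, g b * μ (f ⁻¹' {b}) := by
    intro g
    rw [← SimpleFunc.map_lintegral, ← SimpleFunc.lintegral_eq_lintegral]
    rfl
  set w : E → ℝ := fun b => (μ (f ⁻¹' {b})).toReal
  have hw : ∀ b, μ (f ⁻¹' {b}) = ENNReal.ofReal (w b) := fun b =>
    (ENNReal.ofReal_toReal (measure_ne_top _ _)).symm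
  have hw0 : ∀ b, 0 ≤ w b := fun b => ENNReal.toReal_nonneg
  refine ⟨w, hw0, ?_, ?_⟩
  · have := hint (fun _ => 1)
    simp only [lintegral_const, measure_univ, one_mul, hw] at this
    rw [← ENNReal.ofReal_sum_of_nonneg fun i _ => hw0 i] at this
    exact (ENNReal.ofReal_eq_one.1 this.symm)
  · rw [hint fun b => ∫⁻ y, edist b (f y) ^ (-p) ∂μ, ENNReal.ofReal_sum_of_nonneg]
    · refine Finset.sum_congr rfl fun b _ => ?_
      rw [hint fun c => edist b c ^ (-p), ENNReal.ofReal_sum_of_nonneg, Finset.sum_mul]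
      · refine Finset.sum_congr rfl fun c _ => ?_
        rw [hw, hw, edist_dist, ENNReal.ofReal_rpow_of_nonneg dist_nonneg (by linarith),
          ← ENNReal.ofReal_mul (by positivity), ← ENNReal.ofReal_mul (mul_nonneg (by positivity)
          (hw0 c))]
        congr 1
        ring
      · intro c _
        have := hw0 b; have := hw0 c
        positivity
    · intro b _
      refine Finset.sum_nonneg fun c _ => ?_
      have := hw0 b; have := hw0 c
      positivity

lemma ae_prod_mem_of_mem_probOn {K : Set E} {μ : Measure E} (hμ : μ ∈ probOn K) :
    ∀ᵐ z ∂(μ.prod μ), z.1 ∈ K ∧ z.2 ∈ K := by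
  have := hμ.1
  have h1 := Measure.quasiMeasurePreserving_fst (μ := μ) (ν := μ) |>.ae (ae_mem_of_mem_probOn hμ)
  have h2 := Measure.quasiMeasurePreserving_snd (μ := μ) (ν := μ) |>.ae (ae_mem_of_mem_probOn hμ)
  exact h1.and h2

lemma exists_simpleFunc_tendsto_of_nonempty {K : Set E} (hK : K.Nonempty) :
    ∃ f : ℕ → SimpleFunc E E, (∀ k x, f k x ∈ K) ∧
      ∀ x ∈ K, Tendsto (fun k => f k x) atTop (𝓝 x) := by
  obtain ⟨x₀, hx₀⟩ := hK
  exact ⟨SimpleFunc.approxOn id measurable_id K x₀ hx₀,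
    fun k x => SimpleFunc.approxOn_mem measurable_id hx₀ k x,
    fun x hx => SimpleFunc.tendsto_approxOn measurable_id hx₀ (subset_closure hx)⟩

/-- Fatou's lemma on the product, since the kernel is continuous. -/
lemma lintegral_edist_rpow_le_of_simpleFunc {p : ℝ} {K : Set E} {μ : Measure E}
    (hμ : μ ∈ probOn K) {f : ℕ → SimpleFunc E E}
    (hlim : ∀ x ∈ K, Tendsto (fun k => f k x) atTop (𝓝 x)) {C : ℝ≥0∞}
    (hk : ∀ k, ∫⁻ x, ∫⁻ y, edist (f k x) (f k y) ^ (-p) ∂μ ∂μ ≤ C) : rieszEnergyOf p μ ≤ C := by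
  have := hμ.1
  have hker := continuous_edist_rpow (n := n) (-p)
  have hmeas : ∀ k, Measurable fun z : E × E => edist (f k z.1) (f k z.2) ^ (-p) := fun k =>
    (((f k).measurable.comp measurable_fst).edist
      ((f k).measurable.comp measurable_snd)).pow_const _
  have hk' : ∀ k, ∫⁻ z, edist (f k z.1) (f k z.2) ^ (-p) ∂(μ.prod μ) ≤ C := fun k => by
    rw [← lintegral_lintegral_eq_prod (f := fun x y => edist (f k x) (f k y) ^ (-p)) _ (hmeas k)]
    exact hk k
  have hpt : (fun z : E × E => edist z.1 z.2 ^ (-p)) =ᵐ[μ.prod μ]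
      fun z => liminf (fun k => edist (f k z.1) (f k z.2) ^ (-p)) atTop := by
    filter_upwards [ae_prod_mem_of_mem_probOn hμ] with z hz
    exact (((hker.tendsto (z.1, z.2)).comp
      ((hlim z.1 hz.1).prodMk_nhds (hlim z.2 hz.2))).liminf_eq).symm
  rw [rieszEnergyOf, lintegral_lintegral_eq_prod _ hker.measurable, lintegral_congr_ae hpt]
  refine (lintegral_liminf_le hmeas).trans ?_
  exact liminf_le_of_frequently_le' (Frequently.of_forall hk')

/-- For `p < 0` the energy of a set is at most the supremum of its finite energies. -/
lemma rieszEnergy_le_of_forall_finset {p : ℝ} (hp : p < 0) {K : Set E} {C : ℝ≥0∞}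
    (h : ∀ F : Finset E, ↑F ⊆ K → ∀ w : E → ℝ, (∀ x ∈ F, 0 ≤ w x) → ∑ x ∈ F, w x = 1 →
      ENNReal.ofReal (∑ x ∈ F, ∑ y ∈ F, w x * w y * dist x y ^ (-p)) ≤ C) :
    rieszEnergy p K ≤ C := by
  rw [rieszEnergy, if_neg hp.le.not_gt]
  refine iSup₂_le fun μ hμ => ?_
  have := hμ.1
  obtain ⟨f, hfK, hlim⟩ := exists_simpleFunc_tendsto_of_nonempty (ae_mem_of_mem_probOn hμ).exists
  refine lintegral_edist_rpow_le_of_simpleFunc hμ hlim fun k => ?_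
  obtain ⟨w, hw0, h1, h2⟩ := lintegral_simpleFunc_energy hp μ (f k)
  rw [h2]
  refine h (f k).range ?_ w (fun x _ => hw0 x) h1
  intro b hb
  obtain ⟨x, rfl⟩ := SimpleFunc.mem_range.1 (Finset.mem_coe.1 hb)
  exact hfK k x

lemma rieszCap_of_neg {p : ℝ} (hp : p < 0) (K : Set E) :
    rieszCap p K = rieszEnergy p K ^ (-1 / p) := by
  rw [rieszCap, if_neg hp.ne]

lemma half_edist_rpow_le_rieszEnergy {p : ℝ} (hp : p < 0) {K : Set E} {x y : E} (hx : x ∈ K)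
    (hy : y ∈ K) : ENNReal.ofReal (dist x y ^ (-p) / 2) ≤ rieszEnergy p K := by
  have hw : (fun _ : Fin 2 => (1 / 2 : ℝ)) ∈ stdSimplex ℝ (Fin 2) := by
    constructor
    · intro i; norm_num
    · norm_num
  have := ofReal_energy_le_rieszEnergy hp (K := K) (x := ![x, y])
    (by simp [Fin.forall_fin_two, hx, hy]) hw
  refine le_trans (le_of_eq ?_) this
  congr 1
  have h0 : (0 : ℝ) ^ (-p) = 0 := Real.zero_rpow (by linarith)
  simp [Fin.sum_univ_two, h0, dist_comm y x]
  ring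

lemma rieszCap_pos_of_mem_of_mem {p : ℝ} (hp : p < 0) {K : Set E} {x y : E} (hx : x ∈ K)
    (hy : y ∈ K) (hxy : x ≠ y) : 0 < rieszCap p K := by
  rw [rieszCap_of_neg hp]
  have h : 0 < -1 / p := div_pos_of_neg_of_neg (by norm_num) hp
  refine ENNReal.rpow_pos_of_nonneg ?_ h.le
  refine lt_of_lt_of_le ?_ (half_edist_rpow_le_rieszEnergy hp hx hy)
  have := dist_pos.2 hxy
  rw [ENNReal.ofReal_pos]
  positivity

/-! ### Sets of zero capacity -/

/-- Sets with at most one point have capacity zero. -/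
lemma rieszCap_eq_zero_of_subsingleton (q : ℝ) {K : Set E} (hK : K.Subsingleton) :
    rieszCap q K = 0 := by
  rw [rieszCap_eq_iSup]
  simp only [ENNReal.iSup_eq_zero]
  intro μ hμ
  have := hμ.1
  have hdiag : ∀ x ∈ K, ∀ y ∈ K, edist x y = 0 := fun x hx y hy => by rw [hK hx hy, edist_self]
  unfold capOf
  rcases lt_trichotomy q 0 with hq | rfl | hq
  · have h : 0 < -1 / q := div_pos_of_neg_of_neg (by norm_num) hq
    rw [if_neg hq.ne]
    have : rieszEnergyOf q μ = 0 := by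
      refine le_antisymm ?_ bot_le
      refine (lintegral_lintegral_mono_of_mem_probOn (g := fun _ _ => 0) hμ ?_).trans (by simp)
      intro x hx y hy
      rw [hdiag x hx y hy, ENNReal.zero_rpow_of_pos (by linarith)]
    rw [this, ENNReal.zero_rpow_of_pos h]
  · rw [if_pos rfl, logEnergyOf_of_edist_le_one (fun x hx y hy => by simp [hdiag x hx y hy]) hμ]
    have : ∫⁻ x, ∫⁻ y, (logKernel x y).toENNReal ∂μ ∂μ = ⊤ := by
      refine le_antisymm le_top ?_
      refine le_trans (by simp)
        (lintegral_lintegral_mono_of_mem_probOn (f := fun _ _ => ⊤) hμ ?_)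
      intro x hx y hy
      simp [logKernel, hdiag x hx y hy]
    rw [this]
    simp
  · have h : -1 / q < 0 := div_neg_of_neg_of_pos (by norm_num) hq
    rw [if_neg hq.ne']
    have : rieszEnergyOf q μ = ⊤ := by
      refine le_antisymm le_top ?_
      refine le_trans (by simp)
        (lintegral_lintegral_mono_of_mem_probOn (f := fun _ _ => ⊤) hμ ?_)
      intro x hx y hy
      rw [hdiag x hx y hy, ENNReal.zero_rpow_of_neg (by linarith)]
    rw [this, ENNReal.top_rpow_of_neg h]

lemma exists_ne_of_rieszCap_pos {q : ℝ} {K : Set E} (h : 0 < rieszCap q K) :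
    ∃ x ∈ K, ∃ y ∈ K, x ≠ y := by
  by_contra! hcon
  exact h.ne' (rieszCap_eq_zero_of_subsingleton q fun x hx y hy => hcon x hx y hy)

lemma rieszCap_pos_of_rieszCap_pos {p q : ℝ} (hp : p < 0) {K : Set E} (h : 0 < rieszCap q K) :
    0 < rieszCap p K := by
  obtain ⟨x, hx, y, hy, hxy⟩ := exists_ne_of_rieszCap_pos h
  exact rieszCap_pos_of_mem_of_mem hp hx hy hxy

/-! ### Semicontinuity under weak convergence -/

section Truncation

variable {X : Type*} [MeasurableSpace X] [TopologicalSpace X] [OpensMeasurableSpace X]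

lemma tendsto_lintegral_min {ι : Type*} {L : Filter ι} {μ : ι → ProbabilityMeasure X}
    {ν : ProbabilityMeasure X} (hμ : Tendsto μ L (𝓝 ν)) {f : X → ℝ≥0∞} (hf : Continuous f)
    (M : NNReal) :
    Tendsto (fun i => ∫⁻ x, min (f x) M ∂(μ i : Measure X)) L
      (𝓝 (∫⁻ x, min (f x) M ∂(ν : Measure X))) := by
  have hne : ∀ x, min (f x) M ≠ ⊤ := fun x => ((min_le_right _ _).trans_lt ENNReal.coe_lt_top).ne
  have hc : Continuous fun x => (min (f x) M).toNNReal := by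
    refine continuous_iff_continuousAt.2 fun x => ?_
    exact (ENNReal.tendsto_toNNReal (hne x)).comp
      ((hf.min continuous_const).tendsto x)
  have hle : ∀ x, (min (f x) M).toNNReal ≤ M := fun x => by
    rw [← ENNReal.coe_le_coe, ENNReal.coe_toNNReal (hne x)]
    exact min_le_right _ _
  let g : BoundedContinuousFunction X NNReal :=
    BoundedContinuousFunction.mkOfBound ⟨_, hc⟩ M fun x y => by
      rw [NNReal.dist_eq, abs_le]
      have h1 : (((min (f x) M).toNNReal : NNReal) : ℝ) ≤ M := hle x
      have h2 : (((min (f y) M).toNNReal : NNReal) : ℝ) ≤ M := hle y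
      have h3 := (min (f x) M).toNNReal.coe_nonneg
      have h4 := (min (f y) M).toNNReal.coe_nonneg
      exact ⟨by simp only [ContinuousMap.coe_mk]; linarith,
        by simp only [ContinuousMap.coe_mk]; linarith⟩
  have hg : ∀ x, (g x : ℝ≥0∞) = min (f x) M := fun x => ENNReal.coe_toNNReal (hne x)
  simpa only [hg] using ProbabilityMeasure.tendsto_iff_forall_lintegral_tendsto.1 hμ g

/-- Truncations of `f` are bounded and continuous, so their integrals converge; monotone convergence
then removes the truncation. -/
lemma lintegral_le_of_tendsto_probabilityMeasure {ι : Type*} {L : Filter ι} [L.NeBot]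
    {μ : ι → ProbabilityMeasure X}
    {ν : ProbabilityMeasure X} (hμ : Tendsto μ L (𝓝 ν)) {f : X → ℝ≥0∞} (hf : Continuous f)
    {A : ℝ≥0∞} (hA : Tendsto (fun i => ∫⁻ x, f x ∂(μ i : Measure X)) L (𝓝 A)) :
    ∫⁻ x, f x ∂(ν : Measure X) ≤ A := by
  have hsup : ∀ x, f x = ⨆ k : ℕ, min (f x) ((k : NNReal) : ℝ≥0∞) := fun x => by
    simp only [ENNReal.coe_natCast]
    rw [← inf_iSup_eq, ENNReal.iSup_natCast, inf_top_eq]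
  rw [lintegral_congr hsup, lintegral_iSup]
  · refine iSup_le fun k => ?_
    exact le_of_tendsto_of_tendsto' (tendsto_lintegral_min hμ hf k) hA
      fun i => lintegral_mono fun x => min_le_left _ _
  · exact fun k => hf.measurable.min measurable_const
  · intro k l hkl x
    exact min_le_min_left _ (by simpa using hkl)

lemma le_lintegral_of_tendsto_probabilityMeasure {ι : Type*} {L : Filter ι} [L.NeBot]
    {μ : ι → ProbabilityMeasure X}
    {ν : ProbabilityMeasure X} (hμ : Tendsto μ L (𝓝 ν)) {f : X → ℝ≥0∞} (hf : Continuous f)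
    {M : NNReal} (hM : ∀ i, ∀ᵐ x ∂(μ i : Measure X), f x ≤ M)
    {A : ℝ≥0∞} (hA : Tendsto (fun i => ∫⁻ x, f x ∂(μ i : Measure X)) L (𝓝 A)) :
    A ≤ ∫⁻ x, f x ∂(ν : Measure X) := by
  have h1 : ∀ i, ∫⁻ x, f x ∂(μ i : Measure X) = ∫⁻ x, min (f x) M ∂(μ i : Measure X) := fun i => by
    refine lintegral_congr_ae ?_
    filter_upwards [hM i] with x hx using (min_eq_left hx).symm
  simp only [h1] at hA
  rw [tendsto_nhds_unique hA (tendsto_lintegral_min hμ hf M)]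
  exact lintegral_mono fun x => min_le_left _ _

end Truncation

/-- Upper semicontinuity of `capOf` along weakly convergent measures on sets of diameter at most
one. -/
lemma le_capOf_of_tendsto {ι : Type*} {𝒰 : Ultrafilter ι} {q : ℝ} {K : ι → Set E}
    (hK : ∀ i, ∀ x ∈ K i, ∀ y ∈ K i, edist x y ≤ 1) {μ : ι → ProbabilityMeasure E}
    (hμK : ∀ i, (μ i : Measure E) ∈ probOn (K i)) {ν : ProbabilityMeasure E}
    (hμ : Tendsto μ 𝒰 (𝓝 ν)) {c : ℝ≥0∞}
    (hc : Tendsto (fun i => capOf q (μ i : Measure E)) 𝒰 (𝓝 c)) : c ≤ capOf q (ν : Measure E) := by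
  have hprod : Tendsto (fun i => (μ i).prod (μ i)) 𝒰 (𝓝 (ν.prod ν)) :=
    (ProbabilityMeasure.continuous_prod.tendsto (ν, ν)).comp (hμ.prodMk_nhds hμ)
  -- Along an ultrafilter every `[0, ∞]`-valued family converges, so no subsequences are needed.
  have hlim : ∀ u : ι → ℝ≥0∞, ∃ A, Tendsto u 𝒰 (𝓝 A) := fun u => by
    obtain ⟨A, -, hA⟩ := isCompact_iff_ultrafilter_le_nhds.1 isCompact_univ (𝒰.map u) (by simp)
    exact ⟨A, hA⟩
  have hker := continuous_edist_rpow (n := n) (-q)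
  have hE : ∀ ρ : ProbabilityMeasure E, rieszEnergyOf q (ρ : Measure E) =
      ∫⁻ z, edist z.1 z.2 ^ (-q) ∂((ρ.prod ρ : ProbabilityMeasure (E × E)) : Measure (E × E)) :=
    fun ρ => lintegral_lintegral_eq_prod _ hker.measurable
  have hlog : Continuous fun z : E × E => (logKernel z.1 z.2).toENNReal :=
    EReal.continuous_toENNReal.comp continuous_logKernel
  have hL : ∀ ρ : ProbabilityMeasure E,
      ∫⁻ x, ∫⁻ y, (logKernel x y).toENNReal ∂(ρ : Measure E) ∂(ρ : Measure E) =
      ∫⁻ z, (logKernel z.1 z.2).toENNReal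
        ∂((ρ.prod ρ : ProbabilityMeasure (E × E)) : Measure (E × E)) :=
    fun ρ => lintegral_lintegral_eq_prod _ hlog.measurable
  unfold capOf at hc ⊢
  rcases lt_trichotomy q 0 with hq | rfl | hq
  · simp only [if_neg hq.ne] at hc ⊢
    obtain ⟨A, hA⟩ := hlim fun i => rieszEnergyOf q (μ i : Measure E)
    have h1 := (ENNReal.continuous_rpow_const (y := -1 / q)).tendsto A |>.comp hA
    rw [tendsto_nhds_unique hc h1]
    refine ENNReal.rpow_le_rpow ?_ (div_pos_of_neg_of_neg (by norm_num) hq).le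
    simp only [hE] at hA ⊢
    refine le_lintegral_of_tendsto_probabilityMeasure hprod hker (M := 1) (fun i => ?_) hA
    filter_upwards [ae_prod_mem_of_mem_probOn (hμK i)] with z hz
    exact ENNReal.rpow_le_one (hK i _ hz.1 _ hz.2) (by linarith)
  · simp only [if_true] at hc ⊢
    obtain ⟨A, hA⟩ := hlim fun i =>
      ∫⁻ x, ∫⁻ y, (logKernel x y).toENNReal ∂(μ i : Measure E) ∂(μ i : Measure E)
    simp only [fun i => logEnergyOf_of_edist_le_one (hK i) (hμK i)] at hc
    have h1 : Continuous fun t : ℝ≥0∞ => EReal.exp (-(t : EReal)) :=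
      (EReal.expHomeomorph.continuous).comp (continuous_neg.comp continuous_coe_ennreal_ereal)
    rw [tendsto_nhds_unique hc ((h1.tendsto A).comp hA)]
    refine EReal.exp_monotone (EReal.neg_le_neg_iff.2 ?_)
    simp only [hL] at hA
    have h2 := lintegral_le_of_tendsto_probabilityMeasure hprod hlog hA
    rw [← hL] at h2
    -- Nothing is needed about the negative part for `ν`: discarding it only increases the energy.
    refine le_trans ?_ (EReal.coe_ennreal_le_coe_ennreal_iff.2 h2)
    rw [logEnergyOf]
    exact EReal.sub_le_of_le_add (le_add_of_nonneg_right (EReal.coe_ennreal_nonneg _))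
  · simp only [if_neg hq.ne'] at hc ⊢
    obtain ⟨A, hA⟩ := hlim fun i => rieszEnergyOf q (μ i : Measure E)
    have h1 := (ENNReal.continuous_rpow_const (y := -1 / q)).tendsto A |>.comp hA
    rw [tendsto_nhds_unique hc h1]
    have e : ∀ x : ℝ≥0∞, x ^ (-1 / q) = (x⁻¹) ^ (1 / q) := fun x => by
      rw [neg_div, ENNReal.rpow_neg, ENNReal.inv_rpow]
    rw [e, e]
    refine ENNReal.rpow_le_rpow (ENNReal.inv_le_inv.2 ?_) (by positivity)
    simp only [hE] at hA ⊢
    exact lintegral_le_of_tendsto_probabilityMeasure hprod hker hA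

/-! ### Limits of sets -/

/-- The points that are limits of points of the sets `K i` along `L`. -/
def limPoints {ι : Type*} (L : Filter ι) (K : ι → Set E) : Set E :=
  {x | ∀ ε > 0, ∀ᶠ i in L, (K i ∩ Metric.ball x ε).Nonempty}

lemma isClosed_limPoints {ι : Type*} (L : Filter ι) (K : ι → Set E) :
    IsClosed (limPoints L K) := by
  refine isClosed_of_closure_subset fun x hx ε hε => ?_
  obtain ⟨y, hy, hxy⟩ := Metric.mem_closure_iff.1 hx (ε / 2) (half_pos hε)
  filter_upwards [hy (ε / 2) (half_pos hε)] with i hi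
  obtain ⟨z, hz, hzy⟩ := hi
  refine ⟨z, hz, ?_⟩
  rw [Metric.mem_ball] at hzy ⊢
  linarith [dist_triangle z y x, dist_comm x y]

lemma limPoints_subset {ι : Type*} {L : Filter ι} [L.NeBot] {K : ι → Set E} {B : Set E}
    (hB : IsClosed B) (h : ∀ i, K i ⊆ B) : limPoints L K ⊆ B := by
  intro x hx
  rw [← hB.closure_eq, Metric.mem_closure_iff]
  intro ε hε
  obtain ⟨i, y, hy, hyx⟩ := (hx ε hε).exists
  exact ⟨y, h i hy, by rwa [dist_comm]⟩

/-- A point outside the limit set has a ball that misses `K i` frequently; by the portmanteau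
inequality for open sets this ball is `ν`-null, and local nullness suffices. -/
lemma mem_probOn_limPoints {ι : Type*} {L : Filter ι} {K : ι → Set E}
    {μ : ι → ProbabilityMeasure E} (hμK : ∀ i, (μ i : Measure E) ∈ probOn (K i))
    {ν : ProbabilityMeasure E} (hμ : Tendsto μ L (𝓝 ν)) :
    (ν : Measure E) ∈ probOn (limPoints L K) := by
  refine ⟨inferInstance, measure_null_of_locally_null _ fun x hx => ?_⟩
  obtain ⟨ε, hε, h⟩ : ∃ ε > 0, ¬ ∀ᶠ i in L, (K i ∩ Metric.ball x ε).Nonempty := by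
    by_contra! hcon
    exact hx hcon
  refine ⟨Metric.ball x ε, mem_nhdsWithin_of_mem_nhds (Metric.ball_mem_nhds x hε), ?_⟩
  refine le_antisymm ?_ bot_le
  refine (ProbabilityMeasure.le_liminf_measure_open_of_tendsto hμ Metric.isOpen_ball).trans ?_
  refine liminf_le_of_frequently_le' ?_
  refine (not_eventually.1 h).mono fun i hi => ?_
  refine le_of_eq (measure_mono_null (fun y hy hyK => hi ⟨y, hyK, hy⟩) (hμK i).2)

/-- Lower semicontinuity of the capacity of negative order. -/
lemma rieszCap_le_of_tendsto {ι : Type*} {L : Filter ι} [L.NeBot] {p : ℝ} (hp : p < 0)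
    {K : ι → Set E} {c : ℝ≥0∞} {S : Set E}
    (happ : ∀ x ∈ S, ∃ u : ι → E, (∀ i, u i ∈ K i) ∧ Tendsto u L (𝓝 x))
    (hc : Tendsto (fun i => rieszCap p (K i)) L (𝓝 c)) : rieszCap p (S) ≤ c := by
  have hP : 0 < -1 / p := div_pos_of_neg_of_neg (by norm_num) hp
  have hpp : 0 < -p := by linarith
  have hE : ∀ S : Set E, rieszEnergy p S = rieszCap p S ^ (-p) := fun S => by
    rw [rieszCap_of_neg hp, ← ENNReal.rpow_mul, show -1 / p * -p = 1 by field_simp [hp.ne],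
      ENNReal.rpow_one]
  have hlim : Tendsto (fun i => rieszEnergy p (K i)) L (𝓝 (c ^ (-p))) := by
    simp only [hE]
    exact (ENNReal.continuous_rpow_const.tendsto c).comp hc
  suffices h : rieszEnergy p (S) ≤ c ^ (-p) by
    rw [hE] at h
    exact (ENNReal.rpow_le_rpow_iff hpp).1 h
  -- Move each point of a finite configuration in `S` to its approximants in `K i`, keeping the
  -- weights.
  refine rieszEnergy_le_of_forall_finset hp fun F hF w hw hw1 => ?_
  choose u huK hu using fun x : F => happ x (hF x.2)
  refine le_of_tendsto_of_tendsto' (f := fun i => ENNReal.ofReal (∑ x : F, ∑ y : F,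
    w x * w y * dist (u x i) (u y i) ^ (-p))) ?_ hlim fun i =>
      ofReal_energy_le_rieszEnergy hp (fun x => huK x i) (w := fun x : F => w x) ?_
  · have : ∑ x ∈ F, ∑ y ∈ F, w x * w y * dist x y ^ (-p) = ∑ x : F, ∑ y : F,
        w x * w y * dist (x : E) y ^ (-p) := by
      rw [← Finset.sum_coe_sort]
      exact Finset.sum_congr rfl fun x _ => (Finset.sum_coe_sort F _).symm
    rw [this]
    refine (ENNReal.continuous_ofReal.tendsto _).comp ?_
    refine tendsto_finsetSum _ fun x _ => tendsto_finsetSum _ fun y _ => ?_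
    exact (((hu x).dist (hu y)).rpow_const (Or.inr hpp.le)).const_mul _
  · exact ⟨fun x => hw x x.2, by rw [← hw1]; exact Finset.sum_coe_sort F _⟩

lemma rieszCap_limPoints_le {ι : Type*} {L : Filter ι} [L.NeBot] {p : ℝ} (hp : p < 0)
    {K : ι → Set E} {c : ℝ≥0∞} (hKc : ∀ i, IsCompact (K i)) (hK : ∀ i, (K i).Nonempty)
    (hc : Tendsto (fun i => rieszCap p (K i)) L (𝓝 c)) : rieszCap p (limPoints L K) ≤ c := by
  refine rieszCap_le_of_tendsto hp (fun x hx => ?_) hc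
  choose u hu hux using fun i => (hKc i).exists_infDist_eq_dist (hK i) x
  refine ⟨u, hu, Metric.tendsto_nhds.2 fun ε hε => ?_⟩
  filter_upwards [hx ε hε] with i hi
  obtain ⟨z, hz, hzx⟩ := hi
  rw [dist_comm, ← hux i]
  exact (Metric.infDist_le_dist_of_mem hz).trans_lt (by rwa [dist_comm])

/-- The constant sequence `K` approximates every point of its closure. -/
lemma rieszCap_closure_le {p : ℝ} (hp : p < 0) (K : Set E) :
    rieszCap p (closure K) ≤ rieszCap p K :=
  rieszCap_le_of_tendsto (L := atTop) (K := fun _ : ℕ => K) hp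
    (fun _ hx => mem_closure_iff_seq_limit.1 hx) tendsto_const_nhds

/-! ### Normalization and existence of a maximizer -/

lemma exists_maximal_dist {K : Set E} (hK : IsCompact K) (hne : K.Nonempty) :
    ∃ a ∈ K, ∃ b ∈ K, ∀ x ∈ K, ∀ y ∈ K, dist x y ≤ dist a b := by
  obtain ⟨⟨a, b⟩, hab, hmax⟩ := (hK.prod hK).exists_isMaxOn (hne.prod hne)
    (f := fun z : E × E => dist z.1 z.2) continuous_dist.continuousOn
  refine ⟨a, hab.1, b, hab.2, fun x hx y hy => ?_⟩
  have := isMaxOn_iff.1 hmax (x, y) ⟨hx, hy⟩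
  simpa only using this

/-- Dilation by the inverse diameter. The factor `c` does not depend on `q`, so capacity ratios are
preserved. The ball gives tightness, and the pair at distance one keeps capacities of negative order
away from zero. -/
lemma exists_normalized {K : Set E} (hK : IsCompact K) {p : ℝ} (hpos : 0 < rieszCap p K) :
    ∃ L : Set E, IsCompact L ∧ L ⊆ Metric.closedBall 0 1 ∧ (∀ x ∈ L, ∀ y ∈ L, edist x y ≤ 1) ∧
      (∃ x ∈ L, ∃ y ∈ L, dist x y = 1) ∧
      ∃ c : ℝ, 0 < c ∧ ∀ q, rieszCap q L = ENNReal.ofReal c * rieszCap q K := by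
  obtain ⟨x₀, hx₀, y₀, hy₀, hne⟩ := exists_ne_of_rieszCap_pos hpos
  obtain ⟨a, ha, b, hb, hle⟩ := exists_maximal_dist hK ⟨x₀, hx₀⟩
  have hd : 0 < dist a b := (dist_pos.2 hne).trans_le (hle _ hx₀ _ hy₀)
  obtain ⟨c, hc, hcd⟩ : ∃ c : ℝ, 0 < c ∧ c * dist a b = 1 :=
    ⟨_, inv_pos.2 hd, inv_mul_cancel₀ hd.ne'⟩
  have hdist : ∀ x y : E, dist (c • (x - a)) (c • (y - a)) = c * dist x y := fun x y => by
    rw [dist_smul₀, Real.norm_of_nonneg hc.le, dist_sub_right]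
  have hdist' : ∀ x ∈ K, ∀ y ∈ K, c * dist x y ≤ 1 := fun x hx y hy =>
    (mul_le_mul_of_nonneg_left (hle x hx y hy) hc.le).trans_eq hcd
  refine ⟨(fun x => c • (x - a)) '' K, hK.image (by fun_prop), ?_, ?_, ?_, c, hc,
    fun q => rieszCap_image_smul_sub q hK a hc⟩
  · rintro _ ⟨x, hx, rfl⟩
    have := hdist x a
    rw [sub_self, smul_zero] at this
    rw [Metric.mem_closedBall, this]
    exact hdist' x hx a ha
  · rintro _ ⟨x, hx, rfl⟩ _ ⟨y, hy, rfl⟩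
    rw [edist_dist, hdist]
    exact ENNReal.ofReal_le_one.2 (hdist' x hx y hy)
  · exact ⟨_, ⟨a, ha, rfl⟩, _, ⟨b, hb, rfl⟩, (hdist a b).trans hcd⟩

lemma rieszCap_lt_top (q : ℝ) {K : Set E} (hK : IsCompact K) : rieszCap q K < ⊤ := by
  rcases eq_or_ne (rieszCap q K) 0 with h | h
  · simp [h]
  obtain ⟨L, -, -, h1, -, c, hc, h2⟩ := exists_normalized hK (pos_iff_ne_zero.2 h)
  have := rieszCap_le_one q h1
  rw [h2] at this
  by_contra! htop
  rw [top_le_iff.1 htop, ENNReal.mul_top (by simpa using hc)] at this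
  simp at this

lemma posCapCompacts_nonempty (hn : 1 ≤ n) {p : ℝ} (hp : p < 0) : (posCapCompacts n p).Nonempty := by
  have : Nonempty (Fin n) := ⟨⟨0, hn⟩⟩
  obtain ⟨x, y, hxy⟩ := exists_pair_ne E
  exact ⟨{x, y}, (Set.toFinite _).isCompact,
    rieszCap_pos_of_mem_of_mem hp (Set.mem_insert _ _) (Set.mem_insert_of_mem _ rfl) hxy⟩

lemma isCompact_probabilityMeasure_closedBall :
    IsCompact {μ : ProbabilityMeasure E | μ (Metric.closedBall (0 : E) 1)ᶜ ≤ 0} := by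
  have := isCompact_setOfPred_probabilityMeasure_mass_eq_compl_isCompact_le
    (u := fun _ => 0) (K := fun _ => Metric.closedBall (0 : E) 1) tendsto_const_nhds
    (fun _ => isCompact_closedBall 0 1) (Or.inr monotone_const)
  simpa using this

/-- The capacity ratio attains its supremum. -/
theorem exists_isCapRatioMaximizer (hn : 1 ≤ n) {p : ℝ} (hp : p < 0) (q : ℝ) :
    ∃ K : Set E, IsCapRatioMaximizer p q K := by
  obtain ⟨K₀, hK₀⟩ := posCapCompacts_nonempty hn hp
  set R : ℝ≥0∞ := ⨆ L ∈ posCapCompacts n p, rieszCap q L / rieszCap p L with hR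
  have hRle : ∀ L ∈ posCapCompacts n p, rieszCap q L / rieszCap p L ≤ R := fun L hL =>
    le_iSup₂_of_le L hL le_rfl
  -- If all ratios vanish, every admissible set is a maximizer.
  rcases eq_or_ne R 0 with hR0 | hR0
  · refine ⟨K₀, hK₀, fun L hL => ?_⟩
    have := hRle L hL
    rw [hR0] at this
    exact this.trans bot_le
  -- The measure is recorded along with the set, so that a maximizing sequence comes with measures
  -- to which compactness applies.
  let S : Set (ℝ≥0∞) := {r | ∃ K : Set E, IsCompact K ∧ K ⊆ Metric.closedBall 0 1 ∧
    (∀ x ∈ K, ∀ y ∈ K, edist x y ≤ 1) ∧ (∃ x ∈ K, ∃ y ∈ K, dist x y = 1) ∧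
    ∃ μ : ProbabilityMeasure E, (μ : Measure E) ∈ probOn K ∧
      r = capOf q (μ : Measure E) / rieszCap p K}
  have hSR : R ≤ sSup S := by
    refine iSup₂_le fun K hK => ?_
    obtain ⟨L, h1, h2, h3, h4, c, hc, h5⟩ := exists_normalized hK.1 hK.2
    rw [← ENNReal.mul_div_mul_left (c := ENNReal.ofReal c) _ _ (by simpa using hc) (by simp),
      ← h5, ← h5, rieszCap_eq_iSup q L, ENNReal.iSup_div]
    refine iSup_le fun μ => ?_
    rw [ENNReal.iSup_div]
    refine iSup_le fun hμ => le_sSup ?_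
    exact ⟨L, h1, h2, h3, h4, ⟨μ, hμ.1⟩, hμ, rfl⟩
  have hSne : S.Nonempty := by
    by_contra hcon
    rw [Set.not_nonempty_iff_eq_empty.1 hcon] at hSR
    simp at hSR
    exact hR0 hSR
  obtain ⟨u, -, hu, huS⟩ := exists_seq_tendsto_sSup hSne (OrderTop.bddAbove S)
  choose K hKc hKball hKdiam hKone μ hμK hr using huS
  set 𝒰 : Ultrafilter ℕ := Ultrafilter.of atTop
  have hu' : Tendsto u 𝒰 (𝓝 (sSup S)) := hu.mono_left (Ultrafilter.of_le _)
  obtain ⟨ν, -, hν⟩ := isCompact_iff_ultrafilter_le_nhds.1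
    (isCompact_probabilityMeasure_closedBall (n := n)) (𝒰.map μ) (by
      rw [Ultrafilter.coe_map, le_principal_iff, mem_map]
      refine univ_mem' fun i => ?_
      have := (probOn_mono (hKball i) (hμK i)).2
      exact le_of_eq ((ProbabilityMeasure.null_iff_toMeasure_null _ _).2 this))
  have hlim : ∀ u : ℕ → ℝ≥0∞, ∃ A, Tendsto u 𝒰 (𝓝 A) := fun u => by
    obtain ⟨A, -, hA⟩ := isCompact_iff_ultrafilter_le_nhds.1 isCompact_univ (𝒰.map u) (by simp)
    exact ⟨A, hA⟩
  obtain ⟨A, hA⟩ := hlim fun i => rieszCap p (K i)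
  have hP : 0 < -1 / p := div_pos_of_neg_of_neg (by norm_num) hp
  -- Equal masses on two points at distance one have energy `1 / 2`.
  have hlow : ∀ i, ENNReal.ofReal (1 / 2) ^ (-1 / p) ≤ rieszCap p (K i) := by
    intro i
    obtain ⟨x, hx, y, hy, hxy⟩ := hKone i
    rw [rieszCap_of_neg hp]
    refine ENNReal.rpow_le_rpow ?_ hP.le
    simpa [hxy] using half_edist_rpow_le_rieszEnergy hp hx hy
  have hlow0 : 0 < ENNReal.ofReal (1 / 2) ^ (-1 / p) :=
    ENNReal.rpow_pos (by simp) ENNReal.ofReal_ne_top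
  have hA0 : A ≠ 0 := (hlow0.trans_le (ge_of_tendsto' hA hlow)).ne'
  have hA1 : A ≤ 1 := le_of_tendsto' hA fun i => rieszCap_le_one p (hKdiam i)
  have hAt : A ≠ ⊤ := ne_top_of_le_ne_top ENNReal.one_ne_top hA1
  have hS0 : sSup S ≠ 0 := fun h => hR0 (le_bot_iff.1 (hSR.trans h.le))
  have hcap : Tendsto (fun i => capOf q (μ i : Measure E)) 𝒰 (𝓝 (sSup S * A)) := by
    have := ENNReal.Tendsto.mul hu' (Or.inl hS0) hA (Or.inl hA0)
    refine this.congr fun i => ?_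
    rw [hr i, ENNReal.div_mul_cancel (hlow0.trans_le (hlow i)).ne' (rieszCap_lt_top p (hKc i)).ne]
  set K' := limPoints (𝒰 : Filter ℕ) K
  have hK'c : IsCompact K' := (isCompact_closedBall (0 : E) 1).of_isClosed_subset
    (isClosed_limPoints _ _) (limPoints_subset Metric.isClosed_closedBall hKball)
  have h1 : sSup S * A ≤ rieszCap q K' :=
    (le_capOf_of_tendsto hKdiam hμK hν hcap).trans
      (capOf_le_rieszCap q (mem_probOn_limPoints hμK hν))
  have h2 : rieszCap p K' ≤ A := rieszCap_limPoints_le hp hKc (fun i => by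
    obtain ⟨x, hx, -⟩ := hKone i
    exact ⟨x, hx⟩) hA
  -- Positive `q`-capacity forces two distinct points in `K'`, so `K'` is admissible.
  have hq0 : 0 < rieszCap q K' := (pos_iff_ne_zero.2 (mul_ne_zero hS0 hA0)).trans_le h1
  have hp0 := rieszCap_pos_of_rieszCap_pos hp hq0
  refine ⟨K', ⟨hK'c, hp0⟩, fun L hL => (hRle L hL).trans (hSR.trans ?_)⟩
  rw [ENNReal.le_div_iff_mul_le (Or.inl hp0.ne') (Or.inl (rieszCap_lt_top p hK'c).ne)]
  exact (mul_le_mul_right h2 _).trans h1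

lemma rieszCap_div_lt_top {p q : ℝ} {K : Set E} (hK : K ∈ posCapCompacts n p) :
    rieszCap q K / rieszCap p K < ⊤ :=
  ENNReal.div_lt_top (rieszCap_lt_top q hK.1).ne hK.2.ne'

/-- A set whose `q`-capacity is at least and whose `p`-capacity is at most that of a maximizer is
again a maximizer. -/
lemma IsCapRatioMaximizer.of_le {p q : ℝ} {K L : Set E} (hK : IsCapRatioMaximizer p q K)
    (hL : L ∈ posCapCompacts n p) (hq : rieszCap q K ≤ rieszCap q L)
    (hp : rieszCap p L ≤ rieszCap p K) : IsCapRatioMaximizer p q L :=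
  ⟨hL, fun _ hM => (hK.2 hM).trans (ENNReal.div_le_div hq hp)⟩

/-! ### Convex hulls -/

lemma convexOn_dist_rpow {a : ℝ} (ha : 1 ≤ a) (y : E) :
    ConvexOn ℝ Set.univ fun x : E => dist x y ^ a := by
  have h1 : ConvexOn ℝ Set.univ fun x : E => dist x y := convexOn_univ_dist y
  have h2 : ConvexOn ℝ (Set.Ici 0) fun t : ℝ => t ^ a := convexOn_rpow ha
  refine ⟨convex_univ, fun x _ z _ s t hs ht hst => ?_⟩
  refine (Real.rpow_le_rpow dist_nonneg (h1.2 (Set.mem_univ x) (Set.mem_univ z) hs ht hst)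
    (by linarith)).trans ?_
  exact h2.2 (Set.mem_Ici.2 dist_nonneg) (Set.mem_Ici.2 dist_nonneg) hs ht hst

/-- For `p ≤ -1` passing to the convex hull does not change the energy. -/
lemma rieszEnergy_convexHull_le {p : ℝ} (hp : p ≤ -1) (K : Set E) :
    rieszEnergy p (convexHull ℝ K) ≤ rieszEnergy p K := by
  have hp0 : p < 0 := by linarith
  refine rieszEnergy_le_of_forall_finset hp0 fun F hF w hw hw1 => ?_
  choose ι hι l z hl hl1 hz hlz using fun x : F =>
    mem_convexHull_iff_exists_fintype.1 (hF x.2)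
  -- The mass at each point of `F` is split along a convex combination of points of `K`; Jensen's
  -- inequality in each variable shows that the energy does not decrease.
  have key := ofReal_energy_le_rieszEnergy hp0 (K := K) (ι := Σ x : F, ι x)
    (x := fun s => z s.1 s.2) (fun s => hz s.1 s.2) (w := fun s => w s.1 * l s.1 s.2) ?_
  · refine le_trans (ENNReal.ofReal_le_ofReal ?_) key
    have hsum : ∑ x ∈ F, ∑ y ∈ F, w x * w y * dist x y ^ (-p) = ∑ x : F, ∑ y : F,
        w x * w y * dist (x : E) y ^ (-p) := by
      rw [← Finset.sum_coe_sort]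
      exact Finset.sum_congr rfl fun x _ => (Finset.sum_coe_sort F _).symm
    rw [hsum]
    simp only [Fintype.sum_sigma]
    have jensen : ∀ (x : F) (y : E), dist (x : E) y ^ (-p) ≤
        ∑ i, l x i * dist (z x i) y ^ (-p) := by
      intro x y
      have := (convexOn_dist_rpow (a := -p) (by linarith) y).map_sum_le (t := Finset.univ)
        (w := l x) (p := z x) (fun i _ => hl x i) (hl1 x) (fun _ _ => Set.mem_univ _)
      rw [hlz x] at this
      simpa using this
    refine Finset.sum_le_sum fun x _ => ?_
    rw [Finset.sum_comm]
    refine Finset.sum_le_sum fun y _ => ?_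
    have h2 : dist (x : E) y ^ (-p) ≤
        ∑ i, ∑ j, l x i * l y j * dist (z x i) (z y j) ^ (-p) := by
      refine (jensen x y).trans (Finset.sum_le_sum fun i _ => ?_)
      have := jensen y (z x i)
      rw [dist_comm] at this
      refine (mul_le_mul_of_nonneg_left this (hl x i)).trans_eq ?_
      rw [Finset.mul_sum]
      refine Finset.sum_congr rfl fun j _ => ?_
      rw [dist_comm (z y j)]
      ring
    refine (mul_le_mul_of_nonneg_left h2 (mul_nonneg (hw x x.2) (hw y y.2))).trans_eq ?_
    rw [Finset.mul_sum]
    refine Finset.sum_congr rfl fun i _ => ?_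
    rw [Finset.mul_sum]
    refine Finset.sum_congr rfl fun j _ => ?_
    ring
  · refine ⟨fun s => mul_nonneg (hw _ s.1.2) (hl _ _), ?_⟩
    rw [Fintype.sum_sigma]
    simp only [← Finset.mul_sum, hl1, mul_one]
    rw [← hw1]
    exact Finset.sum_coe_sort F w

lemma rieszCap_convexHull_le {p : ℝ} (hp : p ≤ -1) (K : Set E) :
    rieszCap p (convexHull ℝ K) ≤ rieszCap p K := by
  have hp0 : p < 0 := by linarith
  rw [rieszCap_of_neg hp0, rieszCap_of_neg hp0]
  exact ENNReal.rpow_le_rpow (rieszEnergy_convexHull_le hp K)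
    (div_pos_of_neg_of_neg (by norm_num) hp0).le

/-- Enlarging the set cannot lower the numerator, and neither hull nor closure raises the
denominator. The closure restores compactness. -/
lemma IsCapRatioMaximizer.closure_convexHull {p q : ℝ} (hp : p ≤ -1) {K : Set E}
    (hK : IsCapRatioMaximizer p q K) : IsCapRatioMaximizer p q (closure (convexHull ℝ K)) := by
  have hsub : K ⊆ closure (convexHull ℝ K) := (subset_convexHull ℝ K).trans subset_closure
  refine hK.of_le ⟨?_, hK.1.2.trans_le (rieszCap_mono p hsub)⟩ (rieszCap_mono q hsub)
    ((rieszCap_closure_le (by linarith) _).trans (rieszCap_convexHull_le hp K))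
  exact (isBounded_convexHull.2 hK.1.1.isBounded).isCompact_closure

/-! ### Conditionally negative kernels and Schoenberg's theorem -/

section Schoenberg

variable {ι : Type*} [Fintype ι]

lemma posSemidef_of_sum_nonneg {B : ι → ι → ℝ} (hs : ∀ i j, B i j = B j i)
    (h : ∀ c : ι → ℝ, 0 ≤ ∑ i, ∑ j, c i * c j * B i j) : (Matrix.of B).PosSemidef := by
  refine Matrix.posSemidef_iff_dotProduct_mulVec.2 ⟨?_, fun c => ?_⟩
  · ext i j
    simp [Matrix.conjTranspose_apply, hs i j]
  · refine (h c).trans_eq ?_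
    simp only [dotProduct, Matrix.mulVec, Finset.mul_sum, Matrix.of_apply, Pi.star_apply,
      star_trivial]
    exact Finset.sum_congr rfl fun i _ => Finset.sum_congr rfl fun j _ => by ring

lemma sum_nonneg_of_posSemidef {B : Matrix ι ι ℝ} (h : B.PosSemidef) (c : ι → ℝ) :
    0 ≤ ∑ i, ∑ j, c i * c j * B i j := by
  refine ((Matrix.posSemidef_iff_dotProduct_mulVec.1 h).2 c).trans_eq ?_
  simp only [dotProduct, Matrix.mulVec, Finset.mul_sum, Pi.star_apply, star_trivial]
  exact Finset.sum_congr rfl fun i _ => Finset.sum_congr rfl fun j _ => by ring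

/-- Schur product theorem, by induction on `k`. -/
lemma sum_pow_nonneg {B : ι → ι → ℝ} (hs : ∀ i j, B i j = B j i)
    (h : ∀ c : ι → ℝ, 0 ≤ ∑ i, ∑ j, c i * c j * B i j) (k : ℕ) (c : ι → ℝ) :
    0 ≤ ∑ i, ∑ j, c i * c j * B i j ^ k := by
  suffices H : (Matrix.of fun i j => B i j ^ k).PosSemidef from sum_nonneg_of_posSemidef H c
  induction k with
  | zero =>
    refine posSemidef_of_sum_nonneg (fun i j => by simp) fun c => ?_
    simp only [pow_zero, mul_one]
    rw [← Finset.sum_mul_sum]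
    exact mul_self_nonneg _
  | succ k ih =>
    have e : (Matrix.of fun i j => B i j ^ (k + 1)) =
        (Matrix.of fun i j => B i j ^ k).hadamard (Matrix.of B) := by
      ext i j
      simp [Matrix.hadamard_apply, pow_succ]
    rw [e]
    exact ih.hadamard (posSemidef_of_sum_nonneg hs h)

lemma sum_exp_nonneg {B : ι → ι → ℝ} (hs : ∀ i j, B i j = B j i)
    (h : ∀ c : ι → ℝ, 0 ≤ ∑ i, ∑ j, c i * c j * B i j) (c : ι → ℝ) :
    0 ≤ ∑ i, ∑ j, c i * c j * Real.exp (B i j) := by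
  have hsum : HasSum (fun k : ℕ => ∑ i, ∑ j, c i * c j * (B i j ^ k / k.factorial))
      (∑ i, ∑ j, c i * c j * Real.exp (B i j)) := by
    refine hasSum_sum fun i _ => hasSum_sum fun j _ => HasSum.mul_left _ ?_
    rw [Real.exp_eq_exp_ℝ]
    exact NormedSpace.expSeries_div_hasSum_exp (B i j)
  refine hsum.nonneg fun k => ?_
  have := sum_pow_nonneg hs h k c
  have e : ∑ i, ∑ j, c i * c j * (B i j ^ k / k.factorial) =
      (∑ i, ∑ j, c i * c j * B i j ^ k) / k.factorial := by
    simp only [Finset.sum_div]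
    exact Finset.sum_congr rfl fun i _ => Finset.sum_congr rfl fun j _ => by ring
  rw [e]
  positivity

/-- The exponential of a conditionally negative semidefinite kernel is positive semidefinite. -/
lemma sum_exp_neg_nonneg {A : ι → ι → ℝ} (hs : ∀ i j, A i j = A j i) (h0 : ∀ i, A i i = 0)
    (h : ∀ c : ι → ℝ, ∑ i, c i = 0 → ∑ i, ∑ j, c i * c j * A i j ≤ 0) {s : ℝ} (hs0 : 0 ≤ s)
    (c : ι → ℝ) : 0 ≤ ∑ i, ∑ j, c i * c j * Real.exp (-s * A i j) := by
  classical
  rcases isEmpty_or_nonempty ι with _ | ⟨⟨o⟩⟩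
  · simp
  -- Test the hypothesis on `c` with its total mass removed at the base point `o`.
  have hB : ∀ c : ι → ℝ, 0 ≤ ∑ i, ∑ j, c i * c j * (s * (A i o + A o j - A i j)) := by
    intro c
    set m := ∑ i, c i
    have h1 := h (fun i => c i - m * (if i = o then 1 else 0)) (by
      simp [Finset.sum_sub_distrib, m])
    have e : ∑ i, ∑ j, (c i - m * (if i = o then 1 else 0)) * (c j - m * (if j = o then 1 else 0))
        * A i j = - ∑ i, ∑ j, c i * c j * (A i o + A o j - A i j) := by
      have e1 : ∀ i, ∑ j, (c i - m * (if i = o then 1 else 0)) *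
          (c j - m * (if j = o then 1 else 0)) * A i j =
          (c i - m * (if i = o then 1 else 0)) * (∑ j, c j * A i j - m * A i o) := by
        intro i
        rw [mul_sub, Finset.mul_sum]
        simp only [mul_sub, sub_mul, Finset.sum_sub_distrib, mul_ite, ite_mul, mul_one, mul_zero,
          zero_mul, Finset.sum_ite_eq', Finset.mem_univ, if_true]
        simp only [mul_assoc]
      simp only [e1]
      have e2 : ∑ i, (c i - m * (if i = o then 1 else 0)) * (∑ j, c j * A i j - m * A i o) =
          ∑ i, c i * (∑ j, c j * A i j - m * A i o) - m * (∑ j, c j * A o j - m * A o o) := by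
        simp only [sub_mul (c _), Finset.sum_sub_distrib, mul_ite, ite_mul, mul_one, mul_zero,
          zero_mul, Finset.sum_ite_eq', Finset.mem_univ, if_true]
      rw [e2, h0]
      have e3 : ∑ i, ∑ j, c i * c j * (A i o + A o j - A i j) =
          m * ∑ i, c i * A i o + m * ∑ j, c j * A o j - ∑ i, c i * ∑ j, c j * A i j := by
        simp only [mul_add, mul_sub, Finset.sum_add_distrib, Finset.sum_sub_distrib]
        congr 1
        · congr 1
          · rw [Finset.mul_sum]
            refine Finset.sum_congr rfl fun i _ => ?_
            rw [← Finset.sum_mul, ← Finset.mul_sum]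
            ring
          · simp only [m, Finset.sum_mul_sum, mul_assoc]
        · simp only [Finset.mul_sum, mul_assoc]
      rw [e3]
      have e4 : ∑ i, c i * (∑ j, c j * A i j - m * A i o) =
          ∑ i, c i * ∑ j, c j * A i j - m * ∑ i, c i * A i o := by
        simp only [mul_sub, Finset.sum_sub_distrib]
        congr 1
        rw [Finset.mul_sum]
        exact Finset.sum_congr rfl fun i _ => by ring
      rw [e4]
      ring
    rw [e] at h1
    have e5 : ∑ i, ∑ j, c i * c j * (s * (A i o + A o j - A i j)) =
        s * ∑ i, ∑ j, c i * c j * (A i o + A o j - A i j) := by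
      simp only [Finset.mul_sum]
      exact Finset.sum_congr rfl fun i _ => Finset.sum_congr rfl fun j _ => by ring
    rw [e5]
    exact mul_nonneg hs0 (by linarith)
  have hBs : ∀ i j, s * (A i o + A o j - A i j) = s * (A j o + A o i - A j i) := fun i j => by
    rw [hs i o, hs o j, hs i j]; ring
  refine (sum_exp_nonneg hBs hB fun i => c i * Real.exp (-s * A i o)).trans_eq ?_
  refine Finset.sum_congr rfl fun i _ => Finset.sum_congr rfl fun j _ => ?_
  have : Real.exp (-s * A i j) = Real.exp (-s * A i o) * Real.exp (-s * A j o) *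
      Real.exp (s * (A i o + A o j - A i j)) := by
    rw [← Real.exp_add, ← Real.exp_add, hs o j]
    congr 1
    ring
  rw [this]
  ring

/-- The integrand is at most `t * s ^ (-θ)` near zero, integrable as `θ < 1`, and at most `s ^ (-1 -
θ)` at infinity, integrable as `0 < θ`. -/
lemma integrableOn_one_sub_exp_mul_rpow {θ : ℝ} (h0 : 0 < θ) (h1 : θ < 1) {t : ℝ} (ht : 0 ≤ t) :
    IntegrableOn (fun s : ℝ => (1 - Real.exp (-s * t)) * s ^ (-1 - θ)) (Set.Ioi 0) := by
  have hm : Measurable fun s : ℝ => (1 - Real.exp (-s * t)) * s ^ (-1 - θ) := by fun_prop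
  have hnn : ∀ s : ℝ, 0 < s → 0 ≤ 1 - Real.exp (-s * t) := fun s hs => by
    rw [sub_nonneg, Real.exp_le_one_iff]
    nlinarith
  rw [← Set.Ioc_union_Ioi_eq_Ioi zero_le_one]
  refine IntegrableOn.union ?_ ?_
  · have hi : IntegrableOn (fun s : ℝ => t * s ^ (-θ)) (Set.Ioc 0 1) := by
      have := (intervalIntegral.intervalIntegrable_rpow' (a := 0) (b := 1) (r := -θ) (by linarith))
      rw [intervalIntegrable_iff_integrableOn_Ioc_of_le zero_le_one] at this
      exact this.const_mul t
    refine Integrable.mono' hi hm.aestronglyMeasurable ?_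
    refine (ae_restrict_iff' measurableSet_Ioc).2 (Eventually.of_forall fun s hs => ?_)
    have hs0 : 0 < s := hs.1
    rw [Real.norm_of_nonneg (mul_nonneg (hnn s hs0) (Real.rpow_nonneg hs0.le _))]
    have e : s ^ (-θ) = s * s ^ (-1 - θ) := by
      rw [show -θ = 1 + (-1 - θ) by ring, Real.rpow_add hs0, Real.rpow_one]
    rw [e, ← mul_assoc]
    refine mul_le_mul_of_nonneg_right ?_ (Real.rpow_nonneg hs0.le _)
    have := Real.add_one_le_exp (-s * t)
    linarith
  · have hi : IntegrableOn (fun s : ℝ => s ^ (-1 - θ)) (Set.Ioi 1) :=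
      integrableOn_Ioi_rpow_of_lt (by linarith) one_pos
    refine Integrable.mono' hi hm.aestronglyMeasurable ?_
    refine (ae_restrict_iff' measurableSet_Ioi).2 (Eventually.of_forall fun s hs => ?_)
    have hs0 : 0 < s := one_pos.trans hs
    rw [Real.norm_of_nonneg (mul_nonneg (hnn s hs0) (Real.rpow_nonneg hs0.le _))]
    refine mul_le_of_le_one_left (Real.rpow_nonneg hs0.le _) ?_
    have := Real.exp_pos (-s * t)
    linarith

/-- Substituting `t * s` for `s` writes `t ^ θ` as a mixture of the functions `1 - exp (-s * t)`, up
to a constant. -/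
lemma integral_one_sub_exp_mul_rpow {θ : ℝ} (h0 : 0 < θ) {t : ℝ} (ht : 0 ≤ t) :
    ∫ s in Set.Ioi (0 : ℝ), (1 - Real.exp (-s * t)) * s ^ (-1 - θ) =
      t ^ θ * ∫ s in Set.Ioi (0 : ℝ), (1 - Real.exp (-s)) * s ^ (-1 - θ) := by
  rcases ht.eq_or_lt with rfl | ht
  · simp [Real.zero_rpow h0.ne']
  have h := integral_comp_mul_left_Ioi (fun s : ℝ => (1 - Real.exp (-s)) * s ^ (-1 - θ)) 0 ht
  rw [mul_zero, smul_eq_mul] at h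
  have e : ∫ s in Set.Ioi (0 : ℝ), (1 - Real.exp (-(t * s))) * (t * s) ^ (-1 - θ) =
      t ^ (-1 - θ) * ∫ s in Set.Ioi (0 : ℝ), (1 - Real.exp (-s * t)) * s ^ (-1 - θ) := by
    rw [← integral_const_mul]
    refine setIntegral_congr_fun measurableSet_Ioi fun s hs => ?_
    have hs : 0 < s := hs
    rw [Real.mul_rpow ht.le hs.le]
    ring_nf
  rw [e] at h
  have h2 : t ^ (-1 - θ) * t ^ (1 + θ) = 1 := by
    rw [← Real.rpow_add ht]; simp
  have h3 : t ^ (1 + θ) * t⁻¹ = t ^ θ := by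
    rw [← Real.rpow_neg_one, ← Real.rpow_add ht]; congr 1; ring
  set I := ∫ s in Set.Ioi (0 : ℝ), (1 - Real.exp (-s * t)) * s ^ (-1 - θ)
  set J := ∫ s in Set.Ioi (0 : ℝ), (1 - Real.exp (-s)) * s ^ (-1 - θ)
  calc I = t ^ (1 + θ) * (t ^ (-1 - θ) * I) := by rw [← mul_assoc, mul_comm (t ^ _), h2, one_mul]
    _ = t ^ θ * J := by rw [h, ← mul_assoc, h3]

/-- Schoenberg's theorem: proper powers of a conditionally negative semidefinite kernel that is
positive off the diagonal are strictly conditionally negative definite. -/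
theorem sum_rpow_neg {A : ι → ι → ℝ} (hs : ∀ i j, A i j = A j i) (h0 : ∀ i, A i i = 0)
    (hpos : ∀ i j, i ≠ j → 0 < A i j)
    (h : ∀ c : ι → ℝ, ∑ i, c i = 0 → ∑ i, ∑ j, c i * c j * A i j ≤ 0) {θ : ℝ} (hθ0 : 0 < θ)
    (hθ1 : θ < 1) {c : ι → ℝ} (hc : ∑ i, c i = 0) (hc0 : ∃ i, c i ≠ 0) :
    ∑ i, ∑ j, c i * c j * A i j ^ θ < 0 := by
  classical
  have hA : ∀ i j, 0 ≤ A i j := fun i j => by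
    rcases eq_or_ne i j with rfl | hij
    · exact (h0 i).ge
    · exact (hpos i j hij).le
  set J := ∫ s in Set.Ioi (0 : ℝ), (1 - Real.exp (-s)) * s ^ (-1 - θ)
  have hJ : 0 ≤ J := by
    refine setIntegral_nonneg measurableSet_Ioi fun s hs => ?_
    have hs : 0 < s := hs
    refine mul_nonneg ?_ (Real.rpow_nonneg hs.le _)
    rw [sub_nonneg, Real.exp_le_one_iff]
    linarith
  set g : ℝ → ℝ := fun s => ∑ i, ∑ j, c i * c j * Real.exp (-s * A i j)
  have hint : ∀ i j, IntegrableOn (fun s : ℝ => c i * c j *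
      ((1 - Real.exp (-s * A i j)) * s ^ (-1 - θ))) (Set.Ioi 0) := fun i j =>
    (integrableOn_one_sub_exp_mul_rpow hθ0 hθ1 (hA i j)).const_mul _
  have hcc : ∑ i, ∑ j, c i * c j = 0 := by rw [← Finset.sum_mul_sum, hc, zero_mul]
  have hfun : ∀ s : ℝ, ∑ i, ∑ j, c i * c j * ((1 - Real.exp (-s * A i j)) * s ^ (-1 - θ)) =
      -(g s * s ^ (-1 - θ)) := by
    intro s
    have : ∑ i, ∑ j, c i * c j * ((1 - Real.exp (-s * A i j)) * s ^ (-1 - θ)) =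
        (∑ i, ∑ j, c i * c j - g s) * s ^ (-1 - θ) := by
      simp only [g, ← Finset.sum_sub_distrib, Finset.sum_mul]
      exact Finset.sum_congr rfl fun i _ => Finset.sum_congr rfl fun j _ => by ring
    rw [this, hcc]
    ring
  have hI : (∑ i, ∑ j, c i * c j * A i j ^ θ) * J =
      ∫ s in Set.Ioi (0 : ℝ), -(g s * s ^ (-1 - θ)) := by
    simp only [← hfun]
    rw [integral_finsetSum _ fun i _ => integrable_finsetSum _ fun j _ => hint i j,
      Finset.sum_mul]
    refine Finset.sum_congr rfl fun i _ => ?_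
    rw [integral_finsetSum _ fun j _ => hint i j, Finset.sum_mul]
    refine Finset.sum_congr rfl fun j _ => ?_
    rw [integral_const_mul, integral_one_sub_exp_mul_rpow hθ0 (hA i j), mul_assoc]
  have hgi : IntegrableOn (fun s => g s * s ^ (-1 - θ)) (Set.Ioi 0) := by
    have : IntegrableOn (fun s : ℝ => ∑ i, ∑ j, c i * c j *
      ((1 - Real.exp (-s * A i j)) * s ^ (-1 - θ))) (Set.Ioi 0) :=
      integrable_finsetSum _ fun i _ => integrable_finsetSum _ fun j _ => hint i j
    simp only [hfun] at this
    simpa using this.neg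
  have hg0 : ∀ s, 0 ≤ s → 0 ≤ g s := fun s hs0 => sum_exp_neg_nonneg hs h0 h hs0 c
  -- Strictness comes from large `s`: off-diagonal terms decay because `A i j > 0` there, leaving
  -- the sum of squares.
  have hglim : Tendsto g atTop (𝓝 (∑ i, c i * c i)) := by
    have : ∑ i, c i * c i = ∑ i, ∑ j, c i * c j * (if i = j then 1 else 0) := by simp
    rw [this]
    refine tendsto_finsetSum _ fun i _ => tendsto_finsetSum _ fun j _ => Tendsto.const_mul _ ?_
    split_ifs with hij
    · subst hij
      simp [h0]
    · have h2 := (tendsto_id (α := ℝ) (x := atTop)).atTop_mul_const (hpos i j hij)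
      have := Real.tendsto_exp_neg_atTop_nhds_zero.comp h2
      refine this.congr fun s => ?_
      simp
  have hcpos : 0 < ∑ i, c i * c i := by
    obtain ⟨i, hi⟩ := hc0
    exact Finset.sum_pos' (fun i _ => mul_self_nonneg _)
      ⟨i, Finset.mem_univ _, mul_self_pos.2 hi⟩
  obtain ⟨s₀, hs₀⟩ := eventually_atTop.1 (hglim.eventually_const_lt hcpos)
  have hIpos : 0 < ∫ s in Set.Ioi (0 : ℝ), g s * s ^ (-1 - θ) := by
    rw [setIntegral_pos_iff_support_of_nonneg_ae ?_ hgi]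
    · refine lt_of_lt_of_le ?_ (measure_mono (s := Set.Ioi (max s₀ 0)) ?_)
      · simp
      · intro s hs'
        have h1 : s₀ ≤ s := (le_max_left _ _).trans (le_of_lt hs')
        have h2 : 0 < s := (le_max_right _ _).trans_lt hs'
        exact ⟨(mul_pos (hs₀ s h1) (Real.rpow_pos_of_pos h2 _)).ne', h2⟩
    · refine (ae_restrict_iff' measurableSet_Ioi).2 (Eventually.of_forall fun s hs' => ?_)
      have hs' : 0 < s := hs'
      exact mul_nonneg (hg0 s hs'.le) (Real.rpow_nonneg hs'.le _)
  rw [integral_neg] at hI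
  -- Only `0 ≤ J` is needed: the product of the form with `J` is negative.
  by_contra! hcon
  nlinarith [mul_nonneg hcon hJ]

end Schoenberg

/-! ### Quadratic forms on the simplex -/

section QuadraticForm

variable {ι : Type*} [Fintype ι]

/-- Second-order condition: at a maximizer `w` of a quadratic form on the simplex, the form is
nonpositive on the directions of total mass zero supported where `w` is. -/
lemma sum_nonpos_of_isMaxOn_stdSimplex {A : ι → ι → ℝ} {w : ι → ℝ} (hw : w ∈ stdSimplex ℝ ι)
    (hmax : ∀ v ∈ stdSimplex ℝ ι,
      ∑ i, ∑ j, v i * v j * A i j ≤ ∑ i, ∑ j, w i * w j * A i j)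
    {c : ι → ℝ} (hc : ∑ i, c i = 0) (hcw : ∀ i, w i = 0 → c i = 0) :
    ∑ i, ∑ j, c i * c j * A i j ≤ 0 := by
  have hev : ∀ᶠ ε : ℝ in 𝓝[>] 0, ∀ i, ε * |c i| ≤ w i := by
    refine eventually_all.2 fun i => ?_
    rcases (hw.1 i).eq_or_lt with h | h
    · simp [← h, hcw i h.symm]
    · have : Tendsto (fun ε : ℝ => ε * |c i|) (𝓝[>] 0) (𝓝 0) := by
        have : Tendsto (fun ε : ℝ => ε * |c i|) (𝓝 0) (𝓝 (0 * |c i|)) := tendsto_id.mul_const _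
        rw [zero_mul] at this
        exact this.mono_left nhdsWithin_le_nhds
      exact (this.eventually_lt_const h).mono fun ε hε => hε.le
  obtain ⟨ε, hε, hε0⟩ := (hev.and self_mem_nhdsWithin).exists
  have hε0 : 0 < ε := hε0
  have hmem : ∀ t : ℝ, |t| = ε → (fun i => w i + t * c i) ∈ stdSimplex ℝ ι := by
    intro t ht
    refine ⟨fun i => ?_, ?_⟩
    · have h1 := hε i
      rw [← ht, ← abs_mul] at h1
      linarith [neg_abs_le (t * c i)]
    · rw [Finset.sum_add_distrib, ← Finset.mul_sum, hc, hw.2]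
      ring
  have h1 := hmax _ (hmem ε (abs_of_pos hε0))
  have h2 := hmax _ (hmem (-ε) (by rw [abs_neg, abs_of_pos hε0]))
  -- Adding the values at `w + ε c` and `w - ε c` cancels the first-order terms.
  have e : ∑ i, ∑ j, (w i + ε * c i) * (w j + ε * c j) * A i j +
      ∑ i, ∑ j, (w i + -ε * c i) * (w j + -ε * c j) * A i j =
      2 * ∑ i, ∑ j, w i * w j * A i j + 2 * ε ^ 2 * ∑ i, ∑ j, c i * c j * A i j := by
    simp only [Finset.mul_sum, ← Finset.sum_add_distrib]
    exact Finset.sum_congr rfl fun i _ => Finset.sum_congr rfl fun j _ => by ring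
  have h3 : 0 < ε ^ 2 := by positivity
  by_contra! hcon
  nlinarith [mul_pos h3 hcon]

lemma exists_isMaxOn_stdSimplex [Nonempty ι] (A : ι → ι → ℝ) : ∃ w ∈ stdSimplex ℝ ι,
    ∀ v ∈ stdSimplex ℝ ι, ∑ i, ∑ j, v i * v j * A i j ≤ ∑ i, ∑ j, w i * w j * A i j := by
  classical
  obtain ⟨w, hw, hmax⟩ := (isCompact_stdSimplex ℝ ι).exists_isMaxOn
    ⟨_, single_mem_stdSimplex ℝ (Classical.arbitrary ι)⟩
    (f := fun v : ι → ℝ => ∑ i, ∑ j, v i * v j * A i j) (by fun_prop)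
  exact ⟨w, hw, fun v hv => hmax hv⟩

end QuadraticForm

/-! ### Reduction to at most `n + 1` points for order below `-2` -/

lemma sum_mul_dist_sq {ι : Type*} [Fintype ι] (x : ι → E) {c : ι → ℝ} (hc : ∑ i, c i = 0) :
    ∑ i, ∑ j, c i * c j * dist (x i) (x j) ^ 2 = -2 * ‖∑ i, c i • x i‖ ^ 2 := by
  have h1 : ‖∑ i, c i • x i‖ ^ 2 = ∑ i, ∑ j, c i * c j * inner ℝ (x i) (x j) := by
    rw [← real_inner_self_eq_norm_sq, sum_inner]
    refine Finset.sum_congr rfl fun i _ => ?_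
    rw [inner_sum]
    refine Finset.sum_congr rfl fun j _ => ?_
    rw [real_inner_smul_left, real_inner_smul_right, mul_assoc]
  have h2 : ∀ i j, c i * c j * dist (x i) (x j) ^ 2 = (c i * ‖x i‖ ^ 2) * c j +
      c i * (c j * ‖x j‖ ^ 2) - 2 * (c i * c j * inner ℝ (x i) (x j)) := fun i j => by
    rw [dist_eq_norm, norm_sub_sq_real]
    ring
  simp only [h2, Finset.sum_add_distrib, Finset.sum_sub_distrib, ← Finset.mul_sum, hc, mul_zero,
    ← Finset.sum_mul, zero_mul, Finset.sum_const_zero, h1]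
  ring

/-- If `|x - y| ^ a` with `a > 2` is conditionally negative semidefinite on a finite set, then
the set is affinely independent; in particular it has at most `n + 1` points. -/
lemma card_le_of_sum_dist_rpow_nonpos {a : ℝ} (ha : 2 < a) {ι : Type*} [Fintype ι] {x : ι → E}
    (hx : Function.Injective x)
    (h : ∀ c : ι → ℝ, ∑ i, c i = 0 → ∑ i, ∑ j, c i * c j * dist (x i) (x j) ^ a ≤ 0) :
    Fintype.card ι ≤ n + 1 := by
  suffices H : AffineIndependent ℝ x by
    refine H.card_le_finrank_succ.trans (Nat.succ_le_succ ?_)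
    exact (Submodule.finrank_le _).trans_eq (by simp)
  by_contra hdep
  rw [affineIndependent_iff] at hdep
  push Not at hdep
  obtain ⟨s, w, hw0, hwx, i₀, hi₀, hne⟩ := hdep
  classical
  set c : ι → ℝ := fun i => if i ∈ s then w i else 0
  have hc : ∑ i, c i = 0 := by simpa [c] using hw0
  have hcx : ∑ i, c i • x i = 0 := by simpa [c, ite_smul] using hwx
  -- The power `2 / a < 1` turns the kernel into the squared distance, whose form at `c` is a
  -- multiple of `‖∑ i, c i • x i‖ ^ 2`, which vanishes for an affine dependence.
  have key := sum_rpow_neg (A := fun i j => dist (x i) (x j) ^ a)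
    (fun i j => by rw [dist_comm]) (fun i => by simp [Real.zero_rpow (by linarith : a ≠ 0)])
    (fun i j hij => Real.rpow_pos_of_pos (dist_pos.2 (hx.ne hij)) _) h
    (θ := 2 / a) (by positivity) ((div_lt_one (by linarith)).2 ha) hc ⟨i₀, by simp [c, hi₀, hne]⟩
  have e : ∀ i j, (dist (x i) (x j) ^ a) ^ (2 / a) = dist (x i) (x j) ^ 2 := fun i j => by
    rw [← Real.rpow_mul dist_nonneg, mul_div_cancel₀ _ (by linarith : a ≠ 0)]
    norm_num
  simp only [e] at key
  rw [sum_mul_dist_sq x hc, hcx] at key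
  simp at key

/-- A finite energy of order larger than two is at most one that uses at most `n + 1` points. -/
lemma exists_energy_le_of_card_le {a : ℝ} (ha : 2 < a) {ι : Type*} [Fintype ι] {x : ι → E}
    (hx : Function.Injective x) {v : ι → ℝ} (hv : v ∈ stdSimplex ℝ ι) :
    ∃ (κ : Type) (_ : Fintype κ) (y : κ → E) (w : κ → ℝ), Fintype.card κ ≤ n + 1 ∧
      (∀ k, y k ∈ Set.range x) ∧ w ∈ stdSimplex ℝ κ ∧
      ∑ i, ∑ j, v i * v j * dist (x i) (x j) ^ a ≤
        ∑ k, ∑ l, w k * w l * dist (y k) (y l) ^ a := by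
  classical
  have : Nonempty ι := by
    by_contra hcon
    rw [not_nonempty_iff] at hcon
    simpa using hv.2
  obtain ⟨w, hw, hmax⟩ := exists_isMaxOn_stdSimplex fun i j => dist (x i) (x j) ^ a
  set S : Finset ι := Finset.univ.filter fun i => w i ≠ 0
  have hsum : ∀ g : ι → ℝ, (∀ i, w i = 0 → g i = 0) → ∑ i : S, g i = ∑ i, g i := by
    intro g hg
    rw [Finset.sum_coe_sort S g]
    refine Finset.sum_subset (Finset.subset_univ _) fun i _ hi => hg i ?_
    simpa [S] using hi
  have hcard : Fintype.card S ≤ n + 1 := by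
    refine card_le_of_sum_dist_rpow_nonpos ha (x := fun i : S => x i)
      (hx.comp Subtype.val_injective) fun c hc => ?_
    set d : ι → ℝ := fun i => if h : i ∈ S then c ⟨i, h⟩ else 0
    have hd : ∀ i : S, d i = c i := fun i => by simp [d]
    have hd0 : ∀ i, w i = 0 → d i = 0 := fun i hi => by simp [d, S, hi]
    have h1 : ∑ i, d i = 0 := by
      rw [← hsum d hd0]
      simpa only [hd] using hc
    have h2 := sum_nonpos_of_isMaxOn_stdSimplex hw hmax h1 hd0
    rw [← hsum _ fun i hi => by simp [hd0 i hi]] at h2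
    refine le_trans (le_of_eq ?_) h2
    refine Finset.sum_congr rfl fun i _ => ?_
    rw [← hsum _ fun j hj => by simp [hd0 j hj]]
    simp only [hd]
  -- Reindexing by `Fin` places the index type in `Type`, whatever the universe of `ι`.
  set e := Fintype.equivFin S
  refine ⟨Fin (Fintype.card S), inferInstance, fun k => x (e.symm k), fun k => w (e.symm k),
    by simpa using hcard, fun k => ⟨_, rfl⟩, ⟨fun k => hw.1 _, ?_⟩, (hmax v hv).trans (le_of_eq ?_)⟩
  · rw [e.symm.sum_comp fun i : S => w i, hsum w fun i hi => hi]
    exact hw.2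
  · rw [e.symm.sum_comp fun i : S => ∑ l, w i * w (e.symm l) * dist (x i) (x (e.symm l)) ^ a,
      ← hsum _ fun i hi => by simp [hi]]
    refine Finset.sum_congr rfl fun i _ => ?_
    rw [e.symm.sum_comp fun j : S => w i * w j * dist (x i) (x j) ^ a,
      ← hsum _ fun j hj => by simp [hj]]

/-- Padding with points of weight zero puts all configurations of at most `m` points in one space,
which is compact when `K` is. -/
lemma exists_fin_energy_eq {a : ℝ} {K : Set E} (hK : K.Nonempty) {κ : Type} [Fintype κ]
    {m : ℕ} (hκ : Fintype.card κ ≤ m) {y : κ → E} (hy : ∀ k, y k ∈ K) {w : κ → ℝ}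
    (hw : w ∈ stdSimplex ℝ κ) :
    ∃ (z : Fin m → E) (u : Fin m → ℝ), (∀ i, z i ∈ K) ∧ u ∈ stdSimplex ℝ (Fin m) ∧
      ∑ k, ∑ l, w k * w l * dist (y k) (y l) ^ a = ∑ i, ∑ j, u i * u j * dist (z i) (z j) ^ a := by
  classical
  obtain ⟨x₀, hx₀⟩ := hK
  obtain ⟨e⟩ : Nonempty (κ ↪ Fin m) := Function.Embedding.nonempty_of_card_le (by simpa using hκ)
  set u : Fin m → ℝ := Function.extend e w 0
  set z : Fin m → E := Function.extend e y fun _ => x₀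
  have hu : ∀ k, u (e k) = w k := fun k => e.injective.extend_apply w 0 k
  have hz : ∀ k, z (e k) = y k := fun k => e.injective.extend_apply y _ k
  have hu0 : ∀ i ∉ Set.range e, u i = 0 := fun i hi => by
    simp only [u]
    rw [Function.extend_apply' _ _ _ hi]
    rfl
  refine ⟨z, u, fun i => ?_, ⟨fun i => ?_, ?_⟩, ?_⟩
  · by_cases hi : i ∈ Set.range e
    · obtain ⟨k, rfl⟩ := hi
      rw [hz]; exact hy k
    · simp only [z]
      rw [Function.extend_apply' _ _ _ hi]
      exact hx₀
  · by_cases hi : i ∈ Set.range e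
    · obtain ⟨k, rfl⟩ := hi
      rw [hu]; exact hw.1 k
    · rw [hu0 i hi]
  · rw [← hw.2]
    exact (Fintype.sum_of_injective e e.injective _ _ hu0 fun k => (hu k).symm).symm
  · refine Fintype.sum_of_injective e e.injective _ _ (fun i hi => by simp [hu0 i hi]) fun k => ?_
    refine Fintype.sum_of_injective e e.injective _ _ (fun i hi => by simp [hu0 i hi]) fun l => ?_
    rw [hu, hu, hz, hz]

/-- For `q < -2` the energy of a compact set is attained on a finite subset of at most `n + 1`
points. -/
lemma exists_finset_rieszEnergy_le {q : ℝ} (hq : q < -2) {K : Set E} (hK : IsCompact K)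
    (hne : K.Nonempty) : ∃ F : Finset E, ↑F ⊆ K ∧ F.card ≤ n + 1 ∧
      rieszEnergy q K ≤ rieszEnergy q (F : Set E) := by
  classical
  have hq0 : q < 0 := by linarith
  have hcomp : IsCompact ((Set.univ.pi fun _ : Fin (n + 1) => K) ×ˢ stdSimplex ℝ (Fin (n + 1))) :=
    (isCompact_univ_pi fun _ => hK).prod (isCompact_stdSimplex ℝ _)
  have hcont : Continuous fun s : (Fin (n + 1) → E) × (Fin (n + 1) → ℝ) =>
      ∑ i, ∑ j, s.2 i * s.2 j * dist (s.1 i) (s.1 j) ^ (-q) := by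
    refine continuous_finsetSum _ fun i _ => continuous_finsetSum _ fun j _ => ?_
    refine Continuous.mul (by fun_prop) (Continuous.rpow_const (by fun_prop) fun _ => ?_)
    right; linarith
  obtain ⟨x₀, hx₀⟩ := hne
  obtain ⟨⟨z, u⟩, hzu, hmax⟩ := hcomp.exists_isMaxOn
    ⟨(fun _ => x₀, Pi.single 0 1), fun _ _ => hx₀, single_mem_stdSimplex ℝ 0⟩ hcont.continuousOn
  refine ⟨Finset.univ.image z, ?_, Finset.card_image_le.trans (by simp), ?_⟩
  · intro y hy
    obtain ⟨i, -, rfl⟩ := Finset.mem_image.1 (Finset.mem_coe.1 hy)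
    exact hzu.1 i trivial
  refine le_trans ?_ (ofReal_energy_le_rieszEnergy hq0 (x := z) (w := u) (fun i => by simp) hzu.2)
  refine rieszEnergy_le_of_forall_finset hq0 fun F hF w hw hw1 => ENNReal.ofReal_le_ofReal ?_
  have hv : (fun x : F => w x) ∈ stdSimplex ℝ F :=
    ⟨fun x => hw x x.2, by rw [← hw1]; exact Finset.sum_coe_sort F w⟩
  obtain ⟨κ, _, y, w', hκ, hy, hw', hle⟩ := exists_energy_le_of_card_le (a := -q) (by linarith)
    (x := fun x : F => (x : E)) Subtype.val_injective hv
  obtain ⟨z', u', hz', hu', heq⟩ := exists_fin_energy_eq (a := -q) (K := K) ⟨x₀, hx₀⟩ hκ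
    (y := y) (fun k => by
      obtain ⟨x, hx⟩ := hy k
      rw [← hx]
      exact hF x.2) hw'
  have hsum : ∑ x ∈ F, ∑ y ∈ F, w x * w y * dist x y ^ (-q) = ∑ x : F, ∑ y : F,
      w x * w y * dist (x : E) y ^ (-q) := by
    rw [← Finset.sum_coe_sort]
    exact Finset.sum_congr rfl fun x _ => (Finset.sum_coe_sort F _).symm
  rw [hsum]
  refine hle.trans (heq.le.trans ?_)
  exact isMaxOn_iff.1 hmax (z', u') ⟨fun i _ => hz' i, hu'⟩

/-- Krein–Milman: the hull is generated by its extreme points, which lie in `F` and differ from `x`.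
-/
lemma convexHull_erase_of_notMem_extremePoints {F : Finset E} {x : E} [DecidableEq E]
    (hx : x ∉ (convexHull ℝ (F : Set E)).extremePoints ℝ) :
    convexHull ℝ (F : Set E) ⊆ convexHull ℝ (F.erase x : Set E) := by
  have h1 : (convexHull ℝ (F : Set E)).extremePoints ℝ ⊆ (F.erase x : Set E) := by
    intro y hy
    rw [Finset.coe_erase]
    refine ⟨extremePoints_convexHull_subset hy, ?_⟩
    rintro rfl
    exact hx hy
  rw [← closure_convexHull_extremePoints (F.finite_toSet.isCompact_convexHull ℝ)
    (convex_convexHull ℝ _)]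
  exact closure_minimal (convexHull_mono h1) ((F.erase x).finite_toSet.isClosed_convexHull ℝ)

/-- For `q < -2` some finite set of at most `n + 1` extreme points is a maximizer. -/
theorem exists_finset_isCapRatioMaximizer {p q : ℝ} (hp : p < 0) (hq : q < -2) {K : Set E}
    (hK : IsCapRatioMaximizer p q K) : ∃ F : Finset E,
      IsCapRatioMaximizer p q (F : Set E) ∧ 2 ≤ F.card ∧ F.card ≤ n + 1 ∧
      ∀ x ∈ F, x ∈ (convexHull ℝ (F : Set E)).extremePoints ℝ := by
  classical
  have hq0 : q < 0 := by linarith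
  have transfer : ∀ {L M : Set E}, IsCapRatioMaximizer p q L → M ⊆ L → IsCompact M →
      rieszCap q L ≤ rieszCap q M → IsCapRatioMaximizer p q M := by
    intro L M hL hML hM hle
    have hq1 : 0 < rieszCap q M := (rieszCap_pos_of_rieszCap_pos hq0 hL.1.2).trans_le hle
    exact hL.of_le ⟨hM, rieszCap_pos_of_rieszCap_pos hp hq1⟩ hle (rieszCap_mono p hML)
  have hex : ∃ m, ∃ F : Finset E, IsCapRatioMaximizer p q (F : Set E) ∧ F.card ≤ n + 1 ∧
      F.card = m := by
    obtain ⟨x, hx, -⟩ := exists_ne_of_rieszCap_pos hK.1.2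
    obtain ⟨F, hFK, hcard, hle⟩ := exists_finset_rieszEnergy_le hq hK.1.1 ⟨x, hx⟩
    refine ⟨_, F, transfer hK hFK F.finite_toSet.isCompact ?_, hcard, rfl⟩
    rw [rieszCap_of_neg hq0, rieszCap_of_neg hq0]
    exact ENNReal.rpow_le_rpow hle (div_pos_of_neg_of_neg (by norm_num) hq0).le
  -- Take a maximizer of least cardinality: deleting a nonextreme point would keep the `q`-capacity
  -- and not raise the `p`-capacity.
  obtain ⟨F, hF, hcard, hmin⟩ := Nat.find_spec hex
  refine ⟨F, hF, ?_, hcard, fun x hx => ?_⟩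
  · obtain ⟨x, hx, y, hy, hxy⟩ := exists_ne_of_rieszCap_pos hF.1.2
    exact Finset.one_lt_card.2 ⟨x, hx, y, hy, hxy⟩
  · by_contra hcon
    have hlt := Finset.card_erase_lt_of_mem hx
    refine Nat.find_min hex (hlt.trans_eq hmin) ⟨F.erase x, ?_, by omega, rfl⟩
    refine transfer hF (by simp) (F.erase x).finite_toSet.isCompact ?_
    calc rieszCap q (F : Set E) ≤ rieszCap q (convexHull ℝ (F : Set E)) :=
          rieszCap_mono q (subset_convexHull ℝ _)
      _ ≤ rieszCap q (convexHull ℝ (F.erase x : Set E)) :=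
          rieszCap_mono q (convexHull_erase_of_notMem_extremePoints hcon)
      _ ≤ _ := rieszCap_convexHull_le (by linarith) _

end

theorem mainTheorem4 (n : ℕ) (hn : 1 ≤ n) (p q : ℝ) (hp : p < 0) (hq : q < n) :
    (∃ K : Set (EuclideanSpace ℝ (Fin n)),
      IsCapRatioMaximizer p q K ∧ rieszCap q K / rieszCap p K < ⊤) ∧
    (q < -2 → ∃ E : Finset (EuclideanSpace ℝ (Fin n)),
      IsCapRatioMaximizer p q (E : Set (EuclideanSpace ℝ (Fin n))) ∧
      2 ≤ E.card ∧ E.card ≤ n + 1 ∧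
      ∀ x ∈ E, x ∈ (convexHull ℝ (E : Set (EuclideanSpace ℝ (Fin n)))).extremePoints ℝ) ∧
    (p < -1 → ∃ K : Set (EuclideanSpace ℝ (Fin n)),
      IsCapRatioMaximizer p q K ∧ Convex ℝ K) := by
  obtain ⟨K, hK⟩ := exists_isCapRatioMaximizer hn hp q
  exact ⟨⟨K, hK, rieszCap_div_lt_top hK.1⟩, fun hq2 => exists_finset_isCapRatioMaximizer hp hq2 hK,
    fun hp1 => ⟨_, hK.closure_convexHull hp1.le, (convex_convexHull ℝ K).closure⟩⟩
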